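/- Let $N\ge 1$, $1\le p<\infty$ and $0<s<1$ with $ps\ne 1$, and let $\mathbb R^N_+=\{x\in\mathbb R^N : x_N>0\}$. For a measurable (real- or complex-valued) function $u$ on $\mathbb R^N_+$ put $$E[u]=\iint_{\mathbb R^N_+\times\mathbb R^N_+}\frac{|u(x)-u(y)|^p}{|x-y|^{N+ps}}\,dx\,dy .$$ Let $\mathcal W^s_p(\mathbb R^N_+)$ be the completion of $C_0^\infty(\mathbb R^N_+)$ (smooth functions with compact support in the open half-space) with respect to $E[\cdot]^{1/p}$, regarded as a space of functions (modulo equality almost everywhere): it consists of those $u$ for which there are $\varphi_n\in C_0^\infty(\mathbb R^N_+)$ with $E[\varphi_m-\varphi_n]\to 0$ as $m,n\to\infty$ and $\varphi_n\to u$ almost everywhere on $\mathbb R^N_+$. Set $$\mathcal D_{N,p,s}=2\pi^{(N-1)/2}\,\frac{\Gamma((1+ps)/2)}{\Gamma((N+ps)/2)}\int_0^1\left|1-r^{(ps-1)/p}\right|^p\frac{dr}{(1-r)^{1+ps}},$$ where the integral converges. Then: 1. For all $u\in\mathcal W^s_p(\mathbb R^N_+)$, $$E[u]\ \ge\ \mathcal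 D_{N,p,s}\int_{\mathbb R^N_+}\frac{|u(x)|^p}{x_N^{ps}}\,dx. \qquad(*)$$ 2. The constant is optimal: if $C\in\mathbb R$ and $(*)$ holds for all $u\in\mathcal W^s_p(\mathbb R^N_+)$ with $C$ in place of $\mathcal D_{N,p,s}$, then $C\le\mathcal D_{N,p,s}$. 3. If $p=1$ and $N=1$, then for $u\in\mathcal W^s_p(\mathbb R^N_+)$ equality holds in $(*)$ if and only if $u$ is proportional to a non-increasing function, i.e. there are a scalar $c$ and a non-increasing $g:(0,\infty)\to\mathbb R$ with $u=c\,g$ almost everywhere. 4. If $p>1$, or if $p=1$ and $N\ge 2$, then $(*)$ is strict for every $u\in\mathcal W^s_p(\mathbb R^N_+)$ that does not vanish almost everywhere. -/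

import Mathlib

open MeasureTheory Filter Topology Set
open scoped ENNReal ContDiff

namespace FracHardy

/-- The open half-space `{x ∈ ℝ^N : x_N > 0}` with `N = d + 1`, in Euclidean space. -/
def halfSpace (d : ℕ) : Set (EuclideanSpace ℝ (Fin (d + 1))) :=
  {x | 0 < x (Fin.last d)}

/-- The double integral of `|u(x) - u(y)|^p / |x - y|^(N + p s)` over the product of the
half-space with itself, `N = d + 1`, as an extended nonnegative number. -/
noncomputable def gagliardo {𝕜 : Type*} [RCLike 𝕜] (d : ℕ) (p s : ℝ)
    (u : EuclideanSpace ℝ (Fin (d + 1)) → 𝕜) : ℝ≥0∞ :=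
  ∫⁻ z in halfSpace d ×ˢ halfSpace d,
    ENNReal.ofReal (‖u z.1 - u z.2‖ ^ p / ‖z.1 - z.2‖ ^ (((d + 1 : ℕ) : ℝ) + p * s))

/-- The integral of `|u(x)|^p / x_N^(p s)` over the half-space. -/
noncomputable def hardyTerm {𝕜 : Type*} [RCLike 𝕜] (d : ℕ) (p s : ℝ)
    (u : EuclideanSpace ℝ (Fin (d + 1)) → 𝕜) : ℝ≥0∞ :=
  ∫⁻ x in halfSpace d, ENNReal.ofReal (‖u x‖ ^ p / x (Fin.last d) ^ (p * s))

/-- Smooth functions whose support is a compact subset of the open half-space. -/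
def IsTestFunction {𝕜 : Type*} [RCLike 𝕜] (d : ℕ)
    (φ : EuclideanSpace ℝ (Fin (d + 1)) → 𝕜) : Prop :=
  ContDiff ℝ ∞ φ ∧ HasCompactSupport φ ∧ tsupport φ ⊆ halfSpace d

/-- The completion of the test functions with respect to the Gagliardo seminorm, realized as a
space of functions on the half-space: the almost everywhere limits of those sequences of test
functions that are Cauchy for the seminorm. Only the values of `u` in the half-space matter. -/
def sobolev (𝕜 : Type*) [RCLike 𝕜] (d : ℕ) (p s : ℝ) :
    Set (EuclideanSpace ℝ (Fin (d + 1)) → 𝕜) :=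
  {u | ∃ φ : ℕ → EuclideanSpace ℝ (Fin (d + 1)) → 𝕜,
    (∀ n, IsTestFunction d (φ n)) ∧
    Tendsto (fun mn : ℕ × ℕ => gagliardo d p s (φ mn.1 - φ mn.2)) atTop (𝓝 0) ∧
    ∀ᵐ x ∂(volume.restrict (halfSpace d)), Tendsto (fun n => φ n x) atTop (𝓝 (u x))}

/-- The integrand on `(0, 1)` in the sharp constant. -/
noncomputable def constIntegrand (p s : ℝ) (r : ℝ) : ℝ :=
  |1 - r ^ ((p * s - 1) / p)| ^ p / (1 - r) ^ (1 + p * s)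

/-- The sharp constant in dimension `N`. -/
noncomputable def hardyConst (N : ℕ) (p s : ℝ) : ℝ :=
  2 * Real.pi ^ (((N : ℝ) - 1) / 2) *
    (Real.Gamma ((1 + p * s) / 2) / Real.Gamma (((N : ℝ) + p * s) / 2)) *
    ∫ r in (0 : ℝ)..1, constIntegrand p s r

end FracHardy

/-!
The proof rests on the group structure of the half-space. Identify `η` with the linear map
`S_η x = x + x_N (η - e_N)` (`shear`), which preserves the half-space, has determinant `η_N`, and
satisfies `|x - S_η x| = x_N |η - e_N|`. For fixed `x` every point of the half-space is `S_η x` for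
exactly one `η`, and the substitution `y = S_η x` gives (`gagliardo_eq`)
`E[u] = ∫ |η - e_N| ^ (-(N + p s)) ‖u - u ∘ S_η‖ ^ p dη`,
where the norm is that of `L^p(x_N ^ (-p s) dx)`, whose `p`-th power is the Hardy term.

*Inequality.* In this norm `‖u ∘ S_η‖ = η_N ^ β ‖u‖` with `β = (p s - 1) / p`, so the triangle
inequality gives `‖u - u ∘ S_η‖ ≥ |1 - η_N ^ β| ‖u‖`. The integral of
`|η - e_N| ^ (-(N + p s)) |1 - η_N ^ β| ^ p` over the half-space is the sharp constant
(`lintegral_shearWeight_mul`): integrate over hyperplanes by means of Gaussians, then use the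
symmetry `t ↦ 1 / t` of the remaining integral. This argument needs a finite Hardy term, which
elements of the completion have by Fatou's lemma (`exists_measurable_of_mem_sobolev`).

*Equality.* Equality forces equality in the triangle inequality for almost every `η`, which is a
statement about almost every pair of points. If `p > 1`, strict convexity gives
`u(y) = (y_N / x_N) ^ β u(x)`, so `u` is a multiple of `x_N ^ β`, whose Hardy term is infinite. If
`p = 1`, it says that the value at the upper point lies on the segment from the origin to the
value at the lower one. Hence `|u|` is a non-increasing function of `x_N` (`enorm_ae_eq_slabInf`),
which has infinite Hardy term when `N ≥ 2`; when `N = 1` the values also have a common phase, and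
conversely the pointwise identities integrate to equality.

*Optimality.* The functions `x_N ^ β χ`, with `χ` a cutoff that varies slowly along every `S_η`, are
almost minimizers. Such cutoffs exist since the group is amenable; the ones used are explicit
(`cutoff`, `exists_cutoffDist_le`).
-/

namespace FracHardy

/-! ### The weighted triangle inequality -/

section Pointwise

variable {𝕜 : Type*} [RCLike 𝕜]

/-- Jensen's inequality for `t ↦ t ^ p` with weights `1 - l` and `l`. The equality
case for `p > 1` is `smul_eq_smul_of_rpow_norm_add_eq`. -/
lemma rpow_norm_add_le {p l : ℝ} (hp : 1 ≤ p) (hl0 : 0 < l) (hl1 : l < 1) (a b : 𝕜) :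
    ‖a + b‖ ^ p ≤ (1 - l) ^ (1 - p) * ‖a‖ ^ p + l ^ (1 - p) * ‖b‖ ^ p := by
  have h1 : 0 < 1 - l := by linarith
  have key := (convexOn_rpow hp).2 (x := ‖a‖ / (1 - l)) (y := ‖b‖ / l)
    (div_nonneg (norm_nonneg _) h1.le) (div_nonneg (norm_nonneg _) hl0.le) h1.le hl0.le (by ring)
  simp only [smul_eq_mul] at key
  rw [mul_div_cancel₀ _ h1.ne', mul_div_cancel₀ _ hl0.ne', Real.div_rpow (norm_nonneg _) h1.le,
    Real.div_rpow (norm_nonneg _) hl0.le] at key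
  refine (Real.rpow_le_rpow (norm_nonneg _) (norm_add_le a b) (by linarith)).trans
    (key.trans (le_of_eq ?_))
  rw [Real.rpow_sub h1, Real.rpow_sub hl0, Real.rpow_one, Real.rpow_one]
  ring

lemma smul_eq_smul_of_rpow_norm_add_eq {p l : ℝ} (hp : 1 < p) (hl0 : 0 < l) (hl1 : l < 1)
    {a b : 𝕜}
    (h : ‖a + b‖ ^ p = (1 - l) ^ (1 - p) * ‖a‖ ^ p + l ^ (1 - p) * ‖b‖ ^ p) :
    l • a = (1 - l) • b := by
  have h1 : 0 < 1 - l := by linarith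
  have hx : 0 ≤ ‖a‖ / (1 - l) := div_nonneg (norm_nonneg _) h1.le
  have hy : 0 ≤ ‖b‖ / l := div_nonneg (norm_nonneg _) hl0.le
  have hsum : (1 - l) * (‖a‖ / (1 - l)) ^ p + l * (‖b‖ / l) ^ p = ‖a + b‖ ^ p := by
    rw [h, Real.div_rpow (norm_nonneg _) h1.le, Real.div_rpow (norm_nonneg _) hl0.le,
      Real.rpow_sub h1, Real.rpow_sub hl0, Real.rpow_one, Real.rpow_one]
    ring
  have hle : ‖a + b‖ ^ p ≤ (‖a‖ + ‖b‖) ^ p :=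
    Real.rpow_le_rpow (norm_nonneg _) (norm_add_le a b) (by linarith)
  have heq : ‖a‖ / (1 - l) = ‖b‖ / l := by
    by_contra hne
    have key := (strictConvexOn_rpow hp).2 hx hy hne h1 hl0 (by ring)
    simp only [smul_eq_mul] at key
    rw [mul_div_cancel₀ _ h1.ne', mul_div_cancel₀ _ hl0.ne', hsum] at key
    linarith
  have key := (convexOn_rpow hp.le).2 hx hy h1.le hl0.le (by ring)
  simp only [smul_eq_mul] at key
  rw [mul_div_cancel₀ _ h1.ne', mul_div_cancel₀ _ hl0.ne', hsum] at key
  have hnorm : ‖a + b‖ = ‖a‖ + ‖b‖ :=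
    le_antisymm (norm_add_le _ _)
      ((Real.rpow_le_rpow_iff (by positivity) (by positivity) (by linarith)).1 key)
  have hray := (sameRay_iff_norm_add.2 hnorm).norm_smul_eq
  rw [div_eq_div_iff h1.ne' hl0.ne'] at heq
  rcases eq_or_ne b 0 with rfl | hb
  · have : ‖a‖ = 0 := by
      rw [norm_zero, zero_mul] at heq
      exact (mul_eq_zero.1 heq).resolve_right hl0.ne'
    simp [norm_eq_zero.1 this]
  · have hb' : ‖b‖ ≠ 0 := norm_ne_zero_iff.2 hb
    have : ‖b‖ • (l • a) = ‖b‖ • ((1 - l) • b) := by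
      rw [smul_comm, ← hray, smul_smul, smul_smul, mul_comm l, heq]
    exact smul_right_injective _ hb' this

end Pointwise

section Lp

variable {𝕜 : Type*} [RCLike 𝕜] {X : Type*} [MeasurableSpace X] {μ : Measure X}

/-- The reverse triangle inequality in `L^p` for two functions whose norms have the known
ratio `ρ < 1`; the pointwise inequality `rpow_norm_add_le` with weight `ρ` is integrated. -/
lemma lintegral_rpow_norm_sub_ge_of_lt {p ρ : ℝ} (hp : 1 ≤ p) (hρ0 : 0 < ρ) (hρ1 : ρ < 1)
    {a b : X → 𝕜} (ha : Measurable a) (hb : Measurable b)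
    (hfin : ∫⁻ x, ENNReal.ofReal (‖a x‖ ^ p) ∂μ ≠ ⊤)
    (hab : ∫⁻ x, ENNReal.ofReal (‖b x‖ ^ p) ∂μ =
      ENNReal.ofReal (ρ ^ p) * ∫⁻ x, ENNReal.ofReal (‖a x‖ ^ p) ∂μ) :
    ENNReal.ofReal ((1 - ρ) ^ p) * ∫⁻ x, ENNReal.ofReal (‖a x‖ ^ p) ∂μ ≤
        ∫⁻ x, ENNReal.ofReal (‖a x - b x‖ ^ p) ∂μ ∧
      (∫⁻ x, ENNReal.ofReal (‖a x - b x‖ ^ p) ∂μ =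
          ENNReal.ofReal ((1 - ρ) ^ p) * ∫⁻ x, ENNReal.ofReal (‖a x‖ ^ p) ∂μ →
        ∀ᵐ x ∂μ, ‖a x‖ ^ p = (1 - ρ) ^ (1 - p) * ‖a x - b x‖ ^ p + ρ ^ (1 - p) * ‖b x‖ ^ p) := by
  have h1 : 0 < 1 - ρ := by linarith
  set A := ∫⁻ x, ENNReal.ofReal (‖a x‖ ^ p) ∂μ with hA
  set F := ∫⁻ x, ENNReal.ofReal (‖a x - b x‖ ^ p) ∂μ with hF
  have hpt : ∀ x, ‖a x‖ ^ p ≤ (1 - ρ) ^ (1 - p) * ‖a x - b x‖ ^ p + ρ ^ (1 - p) * ‖b x‖ ^ p := by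
    intro x
    simpa using rpow_norm_add_le hp hρ0 hρ1 (a x - b x) (b x)
  have hmeas : Measurable fun x =>
      ENNReal.ofReal ((1 - ρ) ^ (1 - p) * ‖a x - b x‖ ^ p + ρ ^ (1 - p) * ‖b x‖ ^ p) := by
    fun_prop
  have hint : ∫⁻ x, ENNReal.ofReal
      ((1 - ρ) ^ (1 - p) * ‖a x - b x‖ ^ p + ρ ^ (1 - p) * ‖b x‖ ^ p) ∂μ =
      ENNReal.ofReal ((1 - ρ) ^ (1 - p)) * F + ENNReal.ofReal ρ * A := by
    have hsplit : ∀ x, ENNReal.ofReal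
        ((1 - ρ) ^ (1 - p) * ‖a x - b x‖ ^ p + ρ ^ (1 - p) * ‖b x‖ ^ p) =
        ENNReal.ofReal ((1 - ρ) ^ (1 - p)) * ENNReal.ofReal (‖a x - b x‖ ^ p) +
        ENNReal.ofReal (ρ ^ (1 - p)) * ENNReal.ofReal (‖b x‖ ^ p) := by
      intro x
      rw [ENNReal.ofReal_add (by positivity) (by positivity), ENNReal.ofReal_mul (by positivity),
        ENNReal.ofReal_mul (by positivity)]
    simp_rw [hsplit]
    rw [lintegral_add_left (by fun_prop), lintegral_const_mul _ (by fun_prop),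
      lintegral_const_mul _ (by fun_prop), hab, ← mul_assoc, ← ENNReal.ofReal_mul (by positivity),
      ← Real.rpow_add hρ0, sub_add_cancel, Real.rpow_one]
  have hle : A ≤ ENNReal.ofReal ((1 - ρ) ^ (1 - p)) * F + ENNReal.ofReal ρ * A := by
    rw [← hint]
    exact lintegral_mono fun x => ENNReal.ofReal_le_ofReal (hpt x)
  have hsplitA : A = ENNReal.ofReal (1 - ρ) * A + ENNReal.ofReal ρ * A := by
    rw [← add_mul, ← ENNReal.ofReal_add h1.le hρ0.le, sub_add_cancel, ENNReal.ofReal_one, one_mul]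
  have hρA : ENNReal.ofReal ρ * A ≠ ⊤ := ENNReal.mul_ne_top ENNReal.ofReal_ne_top hfin
  have hle' : ENNReal.ofReal (1 - ρ) * A ≤ ENNReal.ofReal ((1 - ρ) ^ (1 - p)) * F := by
    rw [hsplitA] at hle
    nth_rewrite 2 [← hsplitA] at hle
    exact (ENNReal.add_le_add_iff_right hρA).1 hle
  have hpow : (1 - ρ) ^ (p - 1) * (1 - ρ) = (1 - ρ) ^ p := by
    rw [← Real.rpow_add_one h1.ne', sub_add_cancel]
  have hpow' : (1 - ρ) ^ (p - 1) * (1 - ρ) ^ (1 - p) = 1 := by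
    rw [← Real.rpow_add h1]; simp
  refine ⟨?_, fun heq => ?_⟩
  · calc ENNReal.ofReal ((1 - ρ) ^ p) * A
        = ENNReal.ofReal ((1 - ρ) ^ (p - 1)) * (ENNReal.ofReal (1 - ρ) * A) := by
          rw [← mul_assoc, ← ENNReal.ofReal_mul (by positivity), hpow]
      _ ≤ ENNReal.ofReal ((1 - ρ) ^ (p - 1)) * (ENNReal.ofReal ((1 - ρ) ^ (1 - p)) * F) := by
          gcongr
      _ = F := by
          rw [← mul_assoc, ← ENNReal.ofReal_mul (by positivity), hpow', ENNReal.ofReal_one, one_mul]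
  · have hback : ∫⁻ x, ENNReal.ofReal
        ((1 - ρ) ^ (1 - p) * ‖a x - b x‖ ^ p + ρ ^ (1 - p) * ‖b x‖ ^ p) ∂μ ≤ A := by
      rw [hint, heq, ← mul_assoc, ← ENNReal.ofReal_mul (by positivity), ← hpow, ← mul_assoc,
        mul_comm ((1 - ρ) ^ (1 - p)), hpow', one_mul, ← hsplitA]
    have hae := ae_eq_of_ae_le_of_lintegral_le
      (Eventually.of_forall fun x => ENNReal.ofReal_le_ofReal (hpt x)) hfin hmeas.aemeasurable hback
    filter_upwards [hae] with x hx
    exact (ENNReal.ofReal_eq_ofReal_iff (by positivity) (by positivity)).1 hx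

/-- The reverse triangle inequality in `L^p` for two functions whose norms have the known
ratio `ρ`. If it is an equality and `p > 1` then `b = ρ a`; if it is an equality, `p = 1`
and `ρ ≠ 1`, then at almost every point the smaller of the two values lies on the segment from the
origin to the larger one. -/
lemma lintegral_rpow_norm_sub_ge {p ρ : ℝ} (hp : 1 ≤ p) (hρ0 : 0 < ρ)
    {a b : X → 𝕜} (ha : Measurable a) (hb : Measurable b)
    (hfin : ∫⁻ x, ENNReal.ofReal (‖a x‖ ^ p) ∂μ ≠ ⊤)
    (hab : ∫⁻ x, ENNReal.ofReal (‖b x‖ ^ p) ∂μ =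
      ENNReal.ofReal (ρ ^ p) * ∫⁻ x, ENNReal.ofReal (‖a x‖ ^ p) ∂μ) :
    ENNReal.ofReal (|1 - ρ| ^ p) * ∫⁻ x, ENNReal.ofReal (‖a x‖ ^ p) ∂μ ≤
        ∫⁻ x, ENNReal.ofReal (‖a x - b x‖ ^ p) ∂μ ∧
      (∫⁻ x, ENNReal.ofReal (‖a x - b x‖ ^ p) ∂μ =
          ENNReal.ofReal (|1 - ρ| ^ p) * ∫⁻ x, ENNReal.ofReal (‖a x‖ ^ p) ∂μ →
        (1 < p → ∀ᵐ x ∂μ, b x = ρ • a x) ∧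
        (p = 1 → ∀ᵐ x ∂μ, (ρ < 1 → ‖a x‖ = ‖b x‖ + ‖a x - b x‖) ∧
          (1 < ρ → ‖b x‖ = ‖a x‖ + ‖a x - b x‖))) := by
  rcases lt_trichotomy ρ 1 with hρ | rfl | hρ
  · rw [abs_of_pos (by linarith : 0 < 1 - ρ)]
    obtain ⟨h1, h2⟩ := lintegral_rpow_norm_sub_ge_of_lt hp hρ0 hρ ha hb hfin hab
    refine ⟨h1, fun heq => ⟨fun hp1 => ?_, fun hp1 => ?_⟩⟩
    · filter_upwards [h2 heq] with x hx
      have := smul_eq_smul_of_rpow_norm_add_eq (a := a x - b x) (b := b x) hp1 hρ0 hρ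
        (by simpa using hx)
      rw [smul_sub, sub_smul, one_smul] at this
      exact (sub_left_inj.1 this).symm
    · filter_upwards [h2 heq] with x hx
      subst hp1
      simp only [sub_self, Real.rpow_zero, one_mul, Real.rpow_one] at hx
      exact ⟨fun _ => by rw [hx, add_comm], fun h => absurd h (by linarith)⟩
  · have hp0 : p ≠ 0 := by positivity
    refine ⟨by simp [Real.zero_rpow hp0], fun heq => ⟨fun _ => ?_, fun _ => by simp⟩⟩
    rw [sub_self, abs_zero, Real.zero_rpow hp0, ENNReal.ofReal_zero, zero_mul,
      lintegral_eq_zero_iff (by fun_prop)] at heq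
    filter_upwards [heq] with x hx
    have h0 : ‖a x - b x‖ ^ p = 0 :=
      le_antisymm (ENNReal.ofReal_eq_zero.1 hx) (by positivity)
    rw [Real.rpow_eq_zero (norm_nonneg _) hp0, norm_eq_zero, sub_eq_zero] at h0
    simp [h0]
  · -- Exchange the two functions, which replaces `ρ` by `ρ⁻¹`.
    have hρi0 : 0 < ρ⁻¹ := inv_pos.2 hρ0
    have hρi1 : ρ⁻¹ < 1 := inv_lt_one_of_one_lt₀ hρ
    have hfin' : ∫⁻ x, ENNReal.ofReal (‖b x‖ ^ p) ∂μ ≠ ⊤ := by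
      rw [hab]; exact ENNReal.mul_ne_top ENNReal.ofReal_ne_top hfin
    have hba : ∫⁻ x, ENNReal.ofReal (‖a x‖ ^ p) ∂μ =
        ENNReal.ofReal (ρ⁻¹ ^ p) * ∫⁻ x, ENNReal.ofReal (‖b x‖ ^ p) ∂μ := by
      rw [hab, ← mul_assoc, ← ENNReal.ofReal_mul (by positivity),
        ← Real.mul_rpow hρi0.le hρ0.le, inv_mul_cancel₀ hρ0.ne', Real.one_rpow,
        ENNReal.ofReal_one, one_mul]
    obtain ⟨h1, h2⟩ := lintegral_rpow_norm_sub_ge_of_lt hp hρi0 hρi1 hb ha hfin' hba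
    have hconst : ENNReal.ofReal ((1 - ρ⁻¹) ^ p) * ∫⁻ x, ENNReal.ofReal (‖b x‖ ^ p) ∂μ =
        ENNReal.ofReal (|1 - ρ| ^ p) * ∫⁻ x, ENNReal.ofReal (‖a x‖ ^ p) ∂μ := by
      have h1ρ : 0 < 1 - ρ⁻¹ := by linarith
      rw [hab, ← mul_assoc, ← ENNReal.ofReal_mul (by positivity),
        ← Real.mul_rpow h1ρ.le hρ0.le, sub_mul, inv_mul_cancel₀ hρ0.ne', one_mul,
        abs_sub_comm, abs_of_pos (by linarith : 0 < ρ - 1)]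
    simp_rw [norm_sub_rev (b _) (a _)] at h1 h2
    rw [hconst] at h1 h2
    refine ⟨h1, fun heq => ⟨fun hp1 => ?_, fun hp1 => ?_⟩⟩
    · filter_upwards [h2 heq] with x hx
      have := smul_eq_smul_of_rpow_norm_add_eq (a := b x - a x) (b := a x) hp1 hρi0 hρi1
        (by simpa [norm_sub_rev] using hx)
      rw [smul_sub, sub_smul, one_smul] at this
      have := sub_left_inj.1 this
      rw [← this, smul_smul, mul_inv_cancel₀ hρ0.ne', one_smul]
    · filter_upwards [h2 heq] with x hx
      subst hp1
      simp only [sub_self, Real.rpow_zero, one_mul, Real.rpow_one] at hx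
      exact ⟨fun h => absurd h (by linarith), fun _ => by rw [hx, add_comm]⟩

end Lp

/-! ### The half-space as a group of affine maps -/

section Shear

/-- Euclidean space of dimension `N = d + 1`. -/
abbrev Space (d : ℕ) : Type := EuclideanSpace ℝ (Fin (d + 1))

/-- The last unit vector `e_N`, which is the identity of the group structure on the half-space. -/
noncomputable def unitPoint (d : ℕ) : Space d := EuclideanSpace.single (Fin.last d) 1

/-- The linear map `x ↦ x + x_N (η - e_N)`. It is the right translation by `η` when the half-space
is identified with the group of maps `y ↦ x' + x_N y`. -/
noncomputable def shear {d : ℕ} (η : Space d) : Space d →ₗ[ℝ] Space d :=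
  LinearMap.transvection (EuclideanSpace.proj (𝕜 := ℝ) (Fin.last d)).toLinearMap (η - unitPoint d)

/-- The measure `x_N ^ (-q) dx` on the half-space. -/
noncomputable def hardyMeasure (d : ℕ) (q : ℝ) : Measure (Space d) :=
  (volume.restrict (halfSpace d)).withDensity
    fun x => ENNReal.ofReal (x (Fin.last d) ^ (-q))

variable {d : ℕ}

@[simp] lemma unitPoint_last : unitPoint d (Fin.last d) = 1 := by simp [unitPoint]

lemma shear_apply (η x : Space d) :
    shear η x = x + x (Fin.last d) • (η - unitPoint d) := by
  simp [shear, LinearMap.transvection.apply]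

@[simp] lemma shear_apply_last (η x : Space d) :
    shear η x (Fin.last d) = x (Fin.last d) * η (Fin.last d) := by
  simp [shear_apply]; ring

lemma det_shear (η : Space d) : LinearMap.det (shear η) = η (Fin.last d) := by
  simp [shear]

lemma norm_sub_shear (η x : Space d) :
    ‖x - shear η x‖ = |x (Fin.last d)| * ‖η - unitPoint d‖ := by
  rw [shear_apply, sub_add_cancel_left, norm_neg, norm_smul, Real.norm_eq_abs]

lemma continuous_last : Continuous fun x : Space d => x (Fin.last d) := by fun_prop

lemma isOpen_halfSpace : IsOpen (halfSpace d) := isOpen_lt continuous_const continuous_last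

lemma measurableSet_halfSpace : MeasurableSet (halfSpace d) := isOpen_halfSpace.measurableSet

lemma mem_halfSpace {x : Space d} : x ∈ halfSpace d ↔ 0 < x (Fin.last d) := Iff.rfl

lemma shear_mem_halfSpace {η x : Space d} (hη : η ∈ halfSpace d) :
    shear η x ∈ halfSpace d ↔ x ∈ halfSpace d := by
  rw [mem_halfSpace, mem_halfSpace, shear_apply_last, mul_pos_iff_of_pos_right hη]

@[fun_prop]
lemma measurable_shear {α : Type*} [MeasurableSpace α] {f g : α → Space d} (hf : Measurable f)
    (hg : Measurable g) : Measurable fun a => shear (f a) (g a) := by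
  simp only [shear_apply]
  fun_prop

/-- For a fixed base point `x`, every point of the half-space is `shear η x` for one `η`. -/
lemma lintegral_halfSpace_eq_lintegral_shear {x : Space d} (hx : x ∈ halfSpace d)
    {f : Space d → ℝ≥0∞} (hf : Measurable f) :
    ∫⁻ y in halfSpace d, f y =
      ENNReal.ofReal (x (Fin.last d) ^ (d + 1)) * ∫⁻ η in halfSpace d, f (shear η x) := by
  have hx' : 0 < x (Fin.last d) := hx
  set t := x (Fin.last d) with ht
  set G : Space d → ℝ≥0∞ := (halfSpace d).indicator f with hG
  have hGm : Measurable G := hf.indicator measurableSet_halfSpace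
  have h1 : ∀ η : Space d, (halfSpace d).indicator (fun η => f (shear η x)) η =
      G (t • η + (x - t • unitPoint d)) := by
    intro η
    have : shear η x = t • η + (x - t • unitPoint d) := by
      rw [shear_apply, smul_sub]; abel
    rw [← this, hG]
    by_cases h : η ∈ halfSpace d
    · rw [indicator_of_mem h, indicator_of_mem ((shear_mem_halfSpace h).2 hx)]
    · rw [indicator_of_notMem h, indicator_of_notMem]
      rw [mem_halfSpace, shear_apply_last, mul_pos_iff_of_pos_left hx']
      exact h
  rw [← lintegral_indicator measurableSet_halfSpace, ← lintegral_indicator measurableSet_halfSpace]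
  simp_rw [h1]
  have h2 : ∫⁻ η : Space d, G (t • η + (x - t • unitPoint d)) =
      ∫⁻ y, G (y + (x - t • unitPoint d)) ∂(Measure.map (t • ·) (volume : Measure (Space d))) := by
    have hm : Measurable fun y => G (y + (x - t • unitPoint d)) := hGm.comp (measurable_add_const _)
    rw [lintegral_map hm (measurable_const_smul t)]
  rw [h2, Measure.map_addHaar_smul _ hx'.ne', lintegral_smul_measure,
    lintegral_add_right_eq_self (fun y => G y), smul_eq_mul, ← mul_assoc,
    ← ENNReal.ofReal_mul (by positivity)]
  have : t ^ (d + 1) * |(t ^ Module.finrank ℝ (Space d))⁻¹| = 1 := by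
    rw [finrank_euclideanSpace_fin, abs_of_pos (by positivity), mul_inv_cancel₀ (by positivity)]
  rw [this, ENNReal.ofReal_one, one_mul]

lemma lintegral_comp_shear {η : Space d} (hη : η ∈ halfSpace d)
    {f : Space d → ℝ≥0∞} (hf : Measurable f) :
    ∫⁻ x in halfSpace d, f (shear η x) =
      ENNReal.ofReal (η (Fin.last d))⁻¹ * ∫⁻ x in halfSpace d, f x := by
  have hη' : 0 < η (Fin.last d) := hη
  have hdet : LinearMap.det (shear η) ≠ 0 := by rw [det_shear]; exact hη'.ne'
  rw [← lintegral_indicator measurableSet_halfSpace, ← lintegral_indicator measurableSet_halfSpace]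
  have h1 : ∀ x, (halfSpace d).indicator (fun x => f (shear η x)) x =
      (halfSpace d).indicator f (shear η x) := by
    intro x
    by_cases h : x ∈ halfSpace d
    · rw [indicator_of_mem h, indicator_of_mem ((shear_mem_halfSpace hη).2 h)]
    · rw [indicator_of_notMem h, indicator_of_notMem (mt (shear_mem_halfSpace hη).1 h)]
  simp_rw [h1]
  rw [← lintegral_map (hf.indicator measurableSet_halfSpace) (by fun_prop),
    Measure.map_linearMap_addHaar_eq_smul_addHaar _ hdet, lintegral_smul_measure, det_shear,
    abs_of_pos (by positivity), smul_eq_mul]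

/-- The substitution `y = shear η x` in a double integral over the half-space. -/
lemma lintegral_prod_halfSpace {f : Space d × Space d → ℝ≥0∞} (hf : Measurable f) :
    ∫⁻ z in halfSpace d ×ˢ halfSpace d, f z =
      ∫⁻ η in halfSpace d, ∫⁻ x in halfSpace d,
        ENNReal.ofReal (x (Fin.last d) ^ (d + 1)) * f (x, shear η x) := by
  rw [Measure.volume_eq_prod, ← Measure.prod_restrict, lintegral_prod _ hf.aemeasurable]
  have hm : Measurable fun z : Space d × Space d =>
      ENNReal.ofReal (z.1 (Fin.last d) ^ (d + 1)) * f (z.1, shear z.2 z.1) :=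
    by
    have h : Measurable fun z : Space d × Space d => (z.1, shear z.2 z.1) := by fun_prop
    fun_prop
  calc ∫⁻ x in halfSpace d, ∫⁻ y in halfSpace d, f (x, y)
      = ∫⁻ x in halfSpace d, ∫⁻ η in halfSpace d,
          ENNReal.ofReal (x (Fin.last d) ^ (d + 1)) * f (x, shear η x) := by
        refine setLIntegral_congr_fun measurableSet_halfSpace fun x hx => ?_
        simp only
        have hfx : Measurable fun y => f (x, y) := hf.comp measurable_prodMk_left
        rw [lintegral_halfSpace_eq_lintegral_shear hx hfx, lintegral_const_mul]
        · exact hf.comp (by fun_prop : Measurable fun η => (x, shear η x))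
    _ = _ := lintegral_lintegral_swap hm.aemeasurable

/-- A property of pairs holds almost everywhere if for almost every `η` it holds for almost every
pair `(x, shear η x)`. -/
lemma ae_prod_halfSpace_of_ae_shear {P : Set (Space d × Space d)} (hP : MeasurableSet P)
    (h : ∀ᵐ η ∂(volume.restrict (halfSpace d)), ∀ᵐ x ∂(volume.restrict (halfSpace d)),
      (x, shear η x) ∈ P) :
    ∀ᵐ z ∂((volume.restrict (halfSpace d)).prod (volume.restrict (halfSpace d))), z ∈ P := by
  have hm : Measurable (Pᶜ.indicator (1 : Space d × Space d → ℝ≥0∞)) :=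
    measurable_one.indicator hP.compl
  have h0 : ∫⁻ z in halfSpace d ×ˢ halfSpace d, Pᶜ.indicator 1 z = 0 := by
    rw [lintegral_prod_halfSpace hm]
    refine (lintegral_congr_ae ?_).trans lintegral_zero
    filter_upwards [h] with η hη
    refine (lintegral_congr_ae ?_).trans lintegral_zero
    filter_upwards [hη] with x hx
    simp [hx]
  rw [lintegral_indicator_one hP.compl, Measure.volume_eq_prod, ← Measure.prod_restrict] at h0
  exact h0

lemma measurable_rpow_last (q : ℝ) :
    Measurable fun x : Space d => ENNReal.ofReal (x (Fin.last d) ^ (-q)) := by fun_prop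

lemma lintegral_hardyMeasure (q : ℝ) {f : Space d → ℝ≥0∞} (hf : Measurable f) :
    ∫⁻ x, f x ∂(hardyMeasure d q) =
      ∫⁻ x in halfSpace d, ENNReal.ofReal (x (Fin.last d) ^ (-q)) * f x := by
  rw [hardyMeasure, lintegral_withDensity_eq_lintegral_mul _ (measurable_rpow_last q) hf]
  rfl

lemma ae_hardyMeasure {q : ℝ} {P : Space d → Prop} :
    (∀ᵐ x ∂(hardyMeasure d q), P x) ↔ ∀ᵐ x ∂(volume.restrict (halfSpace d)), P x := by
  rw [hardyMeasure, ae_withDensity_iff (measurable_rpow_last q)]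
  refine eventually_congr ?_
  filter_upwards [ae_restrict_mem measurableSet_halfSpace] with x hx
  have : 0 < x (Fin.last d) ^ (-q) := Real.rpow_pos_of_pos hx _
  simp [this]

lemma lintegral_hardyMeasure_comp_shear (q : ℝ) {η : Space d} (hη : η ∈ halfSpace d)
    {f : Space d → ℝ≥0∞} (hf : Measurable f) :
    ∫⁻ x, f (shear η x) ∂(hardyMeasure d q) =
      ENNReal.ofReal (η (Fin.last d) ^ (q - 1)) * ∫⁻ x, f x ∂(hardyMeasure d q) := by
  have hη' : 0 < η (Fin.last d) := hη
  have hfs : Measurable fun x => f (shear η x) := hf.comp (by fun_prop)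
  rw [lintegral_hardyMeasure q hf, lintegral_hardyMeasure q hfs]
  have h1 : ∀ x ∈ halfSpace d, ENNReal.ofReal (x (Fin.last d) ^ (-q)) * f (shear η x) =
      ENNReal.ofReal (η (Fin.last d) ^ q) *
        (ENNReal.ofReal (shear η x (Fin.last d) ^ (-q)) * f (shear η x)) := by
    intro x hx
    have hx' : 0 < x (Fin.last d) := hx
    rw [← mul_assoc, ← ENNReal.ofReal_mul (by positivity), shear_apply_last,
      Real.mul_rpow hx'.le hη'.le, mul_comm (_ ^ (-q)), ← mul_assoc, ← Real.rpow_add hη',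
      add_neg_cancel, Real.rpow_zero, one_mul]
  have hm : Measurable fun x : Space d => ENNReal.ofReal (x (Fin.last d) ^ (-q)) * f x :=
    (measurable_rpow_last q).mul hf
  have hms : Measurable fun x : Space d =>
      ENNReal.ofReal (shear η x (Fin.last d) ^ (-q)) * f (shear η x) := hm.comp (by fun_prop)
  rw [setLIntegral_congr_fun measurableSet_halfSpace h1,
    lintegral_const_mul _ hms, lintegral_comp_shear hη hm, ← mul_assoc,
    ← ENNReal.ofReal_mul (by positivity), Real.rpow_sub_one hη'.ne', div_eq_mul_inv]

/-! ### The functionals in group coordinates -/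

section Functionals

variable {𝕜 : Type*} [RCLike 𝕜]

/-- The weight `|η - e_N| ^ (-(N + p s))` of the right translation by `η` in the energy. -/
noncomputable def shearWeight (d : ℕ) (p s : ℝ) (η : Space d) : ℝ≥0∞ :=
  ENNReal.ofReal (‖η - unitPoint d‖ ^ (-(((d + 1 : ℕ) : ℝ) + p * s)))

lemma measurable_shearWeight (p s : ℝ) : Measurable (shearWeight d p s) := by
  unfold shearWeight; fun_prop

lemma hardyTerm_eq {p s : ℝ} {u : Space d → 𝕜} (hu : Measurable u) :
    hardyTerm d p s u = ∫⁻ x, ENNReal.ofReal (‖u x‖ ^ p) ∂(hardyMeasure d (p * s)) := by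
  rw [lintegral_hardyMeasure _ (by fun_prop), hardyTerm]
  refine setLIntegral_congr_fun measurableSet_halfSpace fun x hx => ?_
  have hx' : 0 < x (Fin.last d) := hx
  simp only
  rw [← ENNReal.ofReal_mul (by positivity), Real.rpow_neg hx'.le, div_eq_inv_mul]

/-- The energy is a weighted integral of the `p`-th powers of the distances in
`L^p(x_N ^ (-p s) dx)` between a function and its translates. -/
lemma gagliardo_eq {p s : ℝ} {u : Space d → 𝕜} (hu : Measurable u) :
    gagliardo d p s u = ∫⁻ η in halfSpace d, shearWeight d p s η *
      ∫⁻ x, ENNReal.ofReal (‖u x - u (shear η x)‖ ^ p) ∂(hardyMeasure d (p * s)) := by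
  rw [gagliardo, lintegral_prod_halfSpace (by fun_prop)]
  refine setLIntegral_congr_fun measurableSet_halfSpace fun η _ => ?_
  have hus : Measurable fun x => u (shear η x) := hu.comp (by fun_prop)
  simp only
  rw [lintegral_hardyMeasure _ (by fun_prop), ← lintegral_const_mul _ (by fun_prop)]
  refine setLIntegral_congr_fun measurableSet_halfSpace fun x hx => ?_
  have hx' : 0 < x (Fin.last d) := hx
  simp only [shearWeight]
  rw [norm_sub_shear, abs_of_pos hx', ← ENNReal.ofReal_mul (by positivity),
    ← ENNReal.ofReal_mul (by positivity), ← ENNReal.ofReal_mul (by positivity),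
    Real.mul_rpow hx'.le (norm_nonneg _), Real.rpow_neg (norm_nonneg _), Real.rpow_neg hx'.le,
    Real.rpow_add hx', Real.rpow_natCast]
  congr 1
  have : x (Fin.last d) ^ (d + 1) ≠ 0 := by positivity
  have : x (Fin.last d) ^ (p * s) ≠ 0 := by positivity
  field_simp

end Functionals

end Shear

/-! ### Splitting off the last coordinate -/

section Constant

/-- The point of the `N`-dimensional space with last coordinate `t` and other coordinates `z`. -/
noncomputable def joinLast {d : ℕ} (t : ℝ) (z : EuclideanSpace ℝ (Fin d)) : Space d :=
  WithLp.toLp 2 (Fin.snoc (α := fun _ => ℝ) (WithLp.ofLp z) t)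

variable {d : ℕ}

@[simp] lemma joinLast_last (t : ℝ) (z : EuclideanSpace ℝ (Fin d)) :
    joinLast t z (Fin.last d) = t := by
  simp [joinLast]

lemma norm_joinLast_sq (t : ℝ) (z : EuclideanSpace ℝ (Fin d)) :
    ‖joinLast t z‖ ^ 2 = ‖z‖ ^ 2 + t ^ 2 := by
  rw [EuclideanSpace.norm_sq_eq, EuclideanSpace.norm_sq_eq, Fin.sum_univ_castSucc]
  simp [joinLast]

lemma joinLast_sub_unitPoint (t : ℝ) (z : EuclideanSpace ℝ (Fin d)) :
    joinLast t z - unitPoint d = joinLast (t - 1) z := by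
  ext i
  refine Fin.lastCases ?_ (fun j => ?_) i
  · simp
  · simp [joinLast, unitPoint]

lemma measurePreserving_joinLast :
    MeasurePreserving (fun y : ℝ × EuclideanSpace ℝ (Fin d) => joinLast y.1 y.2)
      (volume.prod volume) volume := by
  have h1 : MeasurePreserving (fun y : ℝ × EuclideanSpace ℝ (Fin d) => (y.1, WithLp.ofLp y.2))
      (volume.prod volume) (volume.prod volume) :=
    (MeasurePreserving.id _).prod (PiLp.volume_preserving_ofLp (Fin d))
  have h2 := (volume_preserving_piFinSuccAbove (fun _ : Fin (d + 1) => ℝ) (Fin.last d)).symm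
  have h3 := PiLp.volume_preserving_toLp (Fin (d + 1))
  have h := h3.comp (h2.comp h1)
  have heq : (fun y : ℝ × EuclideanSpace ℝ (Fin d) => joinLast y.1 y.2) =
      WithLp.toLp 2 ∘ ⇑(MeasurableEquiv.piFinSuccAbove (fun _ => ℝ) (Fin.last d)).symm ∘
        fun y => (y.1, WithLp.ofLp y.2) := by
    funext y
    simp [joinLast, MeasurableEquiv.piFinSuccAbove, Fin.insertNthEquiv, Fin.insertNth_last']
  rw [heq]
  exact h

@[fun_prop]
lemma measurable_joinLast {α : Type*} [MeasurableSpace α] {f : α → ℝ}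
    {g : α → EuclideanSpace ℝ (Fin d)} (hf : Measurable f) (hg : Measurable g) :
    Measurable fun a => joinLast (f a) (g a) :=
  measurePreserving_joinLast.measurable.comp (hf.prodMk hg)

lemma lintegral_halfSpace_eq_lintegral_joinLast {f : Space d → ℝ≥0∞} (hf : Measurable f) :
    ∫⁻ x in halfSpace d, f x =
      ∫⁻ t in Ioi (0 : ℝ), ∫⁻ z : EuclideanSpace ℝ (Fin d), f (joinLast t z) := by
  rw [← lintegral_indicator measurableSet_halfSpace, ← lintegral_indicator measurableSet_Ioi,
    ← measurePreserving_joinLast.lintegral_comp (hf.indicator measurableSet_halfSpace),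
    lintegral_prod]
  · refine lintegral_congr fun t => ?_
    by_cases ht : 0 < t
    · rw [indicator_of_mem (mem_Ioi.2 ht)]
      refine lintegral_congr fun z => ?_
      rw [indicator_of_mem]
      simpa [mem_halfSpace] using ht
    · rw [indicator_of_notMem (by simpa using ht)]
      refine (lintegral_congr fun z => ?_).trans lintegral_zero
      rw [indicator_of_notMem]
      simpa [mem_halfSpace] using ht
  · exact ((hf.indicator measurableSet_halfSpace).comp
      measurePreserving_joinLast.measurable).aemeasurable

/-! ### The sharp constant -/

lemma lintegral_rpow_mul_exp_neg_mul_Ioi {a r : ℝ} (ha : 0 < a) (hr : 0 < r) :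
    ∫⁻ t in Ioi (0 : ℝ), ENNReal.ofReal (t ^ (a - 1) * Real.exp (-(r * t))) =
      ENNReal.ofReal ((1 / r) ^ a * Real.Gamma a) := by
  have h := Real.integral_rpow_mul_exp_neg_mul_Ioi ha hr
  have hG := Real.Gamma_pos_of_pos ha
  have hi : IntegrableOn (fun t : ℝ => t ^ (a - 1) * Real.exp (-(r * t))) (Ioi 0) := by
    by_contra hn
    rw [integral_undef hn] at h
    have : 0 < (1 / r) ^ a * Real.Gamma a := by positivity
    linarith
  rw [← h, ofReal_integral_eq_lintegral_ofReal hi]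
  filter_upwards [ae_restrict_mem measurableSet_Ioi] with t ht
  have : (0 : ℝ) < t := ht
  positivity

lemma lintegral_exp_neg_mul_sq_norm {b : ℝ} (hb : 0 < b) :
    ∫⁻ z : EuclideanSpace ℝ (Fin d), ENNReal.ofReal (Real.exp (-b * ‖z‖ ^ 2)) =
      ENNReal.ofReal ((Real.pi / b) ^ ((d : ℝ) / 2)) := by
  have h := GaussianFourier.integral_rexp_neg_mul_sq_norm (V := EuclideanSpace ℝ (Fin d)) hb
  rw [finrank_euclideanSpace_fin] at h
  have hi : Integrable fun z : EuclideanSpace ℝ (Fin d) => Real.exp (-b * ‖z‖ ^ 2) := by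
    by_contra hn
    rw [integral_undef hn] at h
    have := Real.pi_pos
    have : 0 < (Real.pi / b) ^ ((d : ℝ) / 2) := by positivity
    linarith
  rw [← h, ofReal_integral_eq_lintegral_ofReal hi]
  exact Eventually.of_forall fun z => (Real.exp_pos _).le

/-- Integration of the kernel over hyperplanes, by writing the power as a Gamma integral of
Gaussians. -/
lemma lintegral_norm_sq_add_sq_rpow {q t : ℝ} (hq : (d : ℝ) < q) (ht : 0 < t) :
    ∫⁻ z : EuclideanSpace ℝ (Fin d), ENNReal.ofReal ((‖z‖ ^ 2 + t ^ 2) ^ (-(q / 2))) =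
      ENNReal.ofReal (Real.pi ^ ((d : ℝ) / 2) *
        (Real.Gamma ((q - d) / 2) / Real.Gamma (q / 2)) * t ^ ((d : ℝ) - q)) := by
  have hd : (0 : ℝ) ≤ d := Nat.cast_nonneg d
  have hq2 : 0 < q / 2 := by linarith
  have hqd : 0 < (q - d) / 2 := by linarith
  have hG := Real.Gamma_pos_of_pos hq2
  have hπ := Real.pi_pos
  have hG' : ENNReal.ofReal (Real.Gamma (q / 2)) ≠ 0 := by simpa using hG
  rw [← ENNReal.mul_right_inj hG' ENNReal.ofReal_ne_top, ← lintegral_const_mul _ (by fun_prop)]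
  have hz : ∀ z : EuclideanSpace ℝ (Fin d), 0 < ‖z‖ ^ 2 + t ^ 2 := fun z => by positivity
  calc ∫⁻ z : EuclideanSpace ℝ (Fin d), ENNReal.ofReal (Real.Gamma (q / 2)) *
          ENNReal.ofReal ((‖z‖ ^ 2 + t ^ 2) ^ (-(q / 2)))
      = ∫⁻ z : EuclideanSpace ℝ (Fin d), ∫⁻ r in Ioi (0 : ℝ),
          ENNReal.ofReal (r ^ (q / 2 - 1) * Real.exp (-((‖z‖ ^ 2 + t ^ 2) * r))) := by
        refine lintegral_congr fun z => ?_
        rw [lintegral_rpow_mul_exp_neg_mul_Ioi hq2 (hz z), ← ENNReal.ofReal_mul hG.le,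
          one_div, Real.inv_rpow (hz z).le, Real.rpow_neg (hz z).le, mul_comm]
    _ = ∫⁻ r in Ioi (0 : ℝ), ∫⁻ z : EuclideanSpace ℝ (Fin d),
          ENNReal.ofReal (r ^ (q / 2 - 1) * Real.exp (-((‖z‖ ^ 2 + t ^ 2) * r))) :=
        lintegral_lintegral_swap (by fun_prop)
    _ = ∫⁻ r in Ioi (0 : ℝ), ENNReal.ofReal (Real.pi ^ ((d : ℝ) / 2)) *
          ENNReal.ofReal (r ^ ((q - d) / 2 - 1) * Real.exp (-(t ^ 2 * r))) := by
        refine setLIntegral_congr_fun measurableSet_Ioi fun r hr => ?_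
        have hr' : 0 < r := hr
        have h1 : ∀ z : EuclideanSpace ℝ (Fin d),
            ENNReal.ofReal (r ^ (q / 2 - 1) * Real.exp (-((‖z‖ ^ 2 + t ^ 2) * r))) =
            ENNReal.ofReal (r ^ (q / 2 - 1) * Real.exp (-(t ^ 2 * r))) *
              ENNReal.ofReal (Real.exp (-r * ‖z‖ ^ 2)) := by
          intro z
          rw [← ENNReal.ofReal_mul (by positivity), mul_assoc, ← Real.exp_add]
          congr 3; ring
        simp_rw [h1]
        rw [lintegral_const_mul _ (by fun_prop), lintegral_exp_neg_mul_sq_norm hr',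
          ← ENNReal.ofReal_mul (by positivity), ← ENNReal.ofReal_mul (by positivity),
          Real.div_rpow hπ.le hr'.le]
        congr 1
        have : r ^ (q / 2 - 1) = r ^ ((q - d) / 2 - 1) * r ^ ((d : ℝ) / 2) := by
          rw [← Real.rpow_add hr']; congr 1; ring
        rw [this]
        have : r ^ ((d : ℝ) / 2) ≠ 0 := by positivity
        field_simp
    _ = _ := by
        rw [lintegral_const_mul _ (by fun_prop),
          lintegral_rpow_mul_exp_neg_mul_Ioi hqd (by positivity),
          ← ENNReal.ofReal_mul (by positivity), ← ENNReal.ofReal_mul hG.le]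
        congr 1
        have : (1 / t ^ 2) ^ ((q - d) / 2) = t ^ ((d : ℝ) - q) := by
          rw [one_div, ← Real.rpow_natCast t 2, ← Real.rpow_neg ht.le, ← Real.rpow_mul ht.le]
          congr 1; push_cast; ring
        rw [this]
        field_simp

lemma intervalIntegrable_constIntegrand {p s : ℝ} (hp : 1 ≤ p) (hs0 : 0 < s) (hs1 : s < 1) :
    IntervalIntegrable (constIntegrand p s) volume 0 1 := by
  have hp0 : 0 < p := by linarith
  have hps0 : 0 < p * s := by positivity
  have hps1 : p * s < p := by nlinarith
  set β := (p * s - 1) / p with hβ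
  have hβp : β * p = p * s - 1 := by rw [hβ]; field_simp
  have hmeas : Measurable (constIntegrand p s) := by unfold constIntegrand; fun_prop
  have hnn : ∀ r ≤ (1 : ℝ), 0 ≤ constIntegrand p s r := by
    intro r hr
    have : 0 ≤ 1 - r := by linarith
    unfold constIntegrand; positivity
  refine IntervalIntegrable.trans (b := 1 / 2) ?_ ?_
  · -- Near `0` the integrand is dominated by a multiple of `1 + r ^ (p s - 1)`.
    have hg : IntervalIntegrable
        (fun r : ℝ => ((1 / 2) ^ (1 - p) * 2 ^ (1 + p * s)) * (1 + r ^ (p * s - 1))) volume 0 (1 / 2) :=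
      ((intervalIntegrable_const (c := (1 : ℝ))).add
        (intervalIntegral.intervalIntegrable_rpow' (by linarith))).const_mul _
    refine hg.mono_fun' hmeas.aestronglyMeasurable ?_
    rw [uIoc_of_le (by norm_num)]
    filter_upwards [ae_restrict_mem measurableSet_Ioc] with r hr
    rw [Real.norm_of_nonneg (hnn r (by linarith [hr.2]))]
    have h1r : 1 / 2 ≤ 1 - r := by linarith [hr.2]
    have h1 : |1 - r ^ β| ^ p ≤ (1 / 2) ^ (1 - p) * (1 + r ^ (p * s - 1)) := by
      have h := rpow_norm_add_le hp (l := 1 / 2) (by norm_num) (by norm_num) (1 : ℝ) (-(r ^ β))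
      rw [← sub_eq_add_neg, norm_neg, norm_one, Real.one_rpow, Real.norm_eq_abs,
        Real.norm_of_nonneg (Real.rpow_nonneg hr.1.le _), ← Real.rpow_mul hr.1.le, hβp] at h
      norm_num only at h ⊢
      linarith
    have h2 : ((1 - r) ^ (1 + p * s))⁻¹ ≤ 2 ^ (1 + p * s) := by
      rw [← Real.inv_rpow (by linarith)]
      refine Real.rpow_le_rpow (by simp; linarith) ?_ (by linarith)
      rw [inv_le_comm₀ (by linarith) (by norm_num)]
      linarith
    calc constIntegrand p s r = |1 - r ^ β| ^ p * ((1 - r) ^ (1 + p * s))⁻¹ := by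
          rw [constIntegrand, div_eq_mul_inv]
      _ ≤ ((1 / 2) ^ (1 - p) * (1 + r ^ (p * s - 1))) * 2 ^ (1 + p * s) := by
          have : 0 ≤ r ^ (p * s - 1) := Real.rpow_nonneg hr.1.le _
          gcongr
      _ = _ := by ring
  · -- Near `1` the integrand is dominated by a multiple of `(1 - r) ^ (p - 1 - p s)`.
    obtain ⟨L, hL⟩ := isCompact_Icc.exists_bound_of_continuousOn (s := Icc (1 / 2 : ℝ) 1)
      (f := fun r : ℝ => β * r ^ (β - 1)) (by
        refine continuousOn_const.mul (ContinuousOn.rpow_const continuousOn_id fun r hr => ?_)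
        left
        have : (0 : ℝ) < r := by linarith [hr.1]
        exact this.ne')
    have hL0 : 0 ≤ L := (norm_nonneg _).trans (hL 1 ⟨by norm_num, le_rfl⟩)
    have hlip : ∀ r ∈ Icc (1 / 2 : ℝ) 1, |1 - r ^ β| ≤ L * (1 - r) := by
      intro r hr
      have h := (convex_Icc (1 / 2 : ℝ) 1).norm_image_sub_le_of_norm_hasDerivWithin_le
        (f := fun r : ℝ => r ^ β) (f' := fun r => β * r ^ (β - 1)) (C := L)
        (fun x hx => (Real.hasDerivAt_rpow_const
          (Or.inl (by linarith [hx.1] : (0 : ℝ) < x).ne')).hasDerivWithinAt)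
        hL hr ⟨by norm_num, le_rfl⟩
      simpa [Real.norm_eq_abs, abs_of_nonneg (by linarith [hr.2] : 0 ≤ 1 - r)] using h
    have hg : IntervalIntegrable
        (fun r : ℝ => L ^ p * (1 - r) ^ (p - (1 + p * s))) volume (1 / 2) 1 := by
      have h := (intervalIntegral.intervalIntegrable_rpow' (a := 1 - 1 / 2) (b := 1 - 1)
        (r := p - (1 + p * s)) (by linarith)).comp_sub_left 1
      simp only [sub_sub_cancel] at h
      exact h.const_mul _
    refine hg.mono_fun' hmeas.aestronglyMeasurable ?_
    rw [uIoc_of_le (by norm_num)]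
    filter_upwards [ae_restrict_mem measurableSet_Ioc,
      ae_restrict_of_ae (compl_mem_ae_iff.2 (measure_singleton (1 : ℝ)))] with r hr hr1
    have hr1' : 0 < 1 - r := by
      have := lt_of_le_of_ne hr.2 (by simpa using hr1)
      linarith
    rw [Real.norm_of_nonneg (hnn r hr.2), constIntegrand, Real.rpow_sub hr1', ← mul_div_assoc,
      ← Real.mul_rpow hL0 hr1'.le]
    gcongr
    exact hlip r ⟨hr.1.le, hr.2⟩

/-- The substitution `t ↦ t⁻¹` shows that `(0, 1)` and `(1, ∞)` contribute equally. -/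
lemma lintegral_Ioi_one_eq {p s : ℝ} (hp : 1 ≤ p) :
    ∫⁻ t in Ioi (1 : ℝ), ENNReal.ofReal
        (|1 - t ^ ((p * s - 1) / p)| ^ p * |t - 1| ^ (-(1 + p * s))) =
      ∫⁻ t in Ioo (0 : ℝ) 1, ENNReal.ofReal
        (|1 - t ^ ((p * s - 1) / p)| ^ p * |t - 1| ^ (-(1 + p * s))) := by
  have hp0 : 0 < p := by linarith
  set β := (p * s - 1) / p with hβ
  have hβp : β * p = p * s - 1 := by rw [hβ]; field_simp
  have himg : (fun t : ℝ => t⁻¹) '' Ioo 0 1 = Ioi 1 := by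
    ext y
    constructor
    · rintro ⟨t, ht, rfl⟩
      exact (one_lt_inv₀ ht.1).2 ht.2
    · intro hy
      have hy' : (1 : ℝ) < y := hy
      exact ⟨y⁻¹, ⟨by positivity, inv_lt_one_of_one_lt₀ hy'⟩, inv_inv y⟩
  rw [← himg, lintegral_image_eq_lintegral_abs_deriv_mul measurableSet_Ioo
    (f' := fun t => -(t ^ 2)⁻¹)
    (fun t ht => (hasDerivAt_inv ht.1.ne').hasDerivWithinAt) inv_injective.injOn]
  refine setLIntegral_congr_fun measurableSet_Ioo fun t ht => ?_
  have ht0 : 0 < t := ht.1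
  have ht1 : 0 < 1 - t := by linarith [ht.2]
  rw [← ENNReal.ofReal_mul (abs_nonneg _)]
  congr 1
  have h1 : 1 - t⁻¹ ^ β = -(t ^ (-β) * (1 - t ^ β)) := by
    rw [Real.inv_rpow ht0.le, Real.rpow_neg ht0.le]
    have : t ^ β ≠ 0 := by positivity
    field_simp
    ring
  have h2 : t⁻¹ - 1 = t⁻¹ * (1 - t) := by field_simp
  rw [h1, h2, abs_neg, abs_neg, abs_mul, abs_mul, abs_inv, abs_inv, abs_of_pos ht1, abs_sub_comm t 1,
    abs_of_pos ht1, abs_of_pos ht0, abs_of_pos (by positivity : 0 < t ^ 2),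
    abs_of_pos (by positivity : 0 < t ^ (-β)), Real.mul_rpow (by positivity) (abs_nonneg _),
    Real.mul_rpow (by positivity) ht1.le, ← Real.rpow_mul ht0.le, Real.inv_rpow ht0.le,
    Real.rpow_neg ht0.le (1 + p * s), inv_inv]
  have h3 : (t ^ 2)⁻¹ * (t ^ (-β * p) * t ^ (1 + p * s)) = 1 := by
    rw [← Real.rpow_add ht0, ← Real.rpow_natCast t 2, ← Real.rpow_neg ht0.le, ← Real.rpow_add ht0]
    have : -((2 : ℕ) : ℝ) + (-β * p + (1 + p * s)) = 0 := by
      rw [neg_mul, hβp]; push_cast; ring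
    rw [this, Real.rpow_zero]
  calc _ = ((t ^ 2)⁻¹ * (t ^ (-β * p) * t ^ (1 + p * s))) *
        (|1 - t ^ β| ^ p * (1 - t) ^ (-(1 + p * s))) := by ring
    _ = _ := by rw [h3, one_mul]

/-- The sharp constant is the energy weight integrated against the `p`-th power of the reverse
triangle inequality's constant `|1 - η_N ^ ((p s - 1) / p)|`. -/
lemma lintegral_shearWeight_mul {p s : ℝ} (hp : 1 ≤ p) (hs0 : 0 < s) (hs1 : s < 1) :
    ∫⁻ η in halfSpace d, shearWeight d p s η *
        ENNReal.ofReal (|1 - η (Fin.last d) ^ ((p * s - 1) / p)| ^ p) =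
      ENNReal.ofReal (hardyConst (d + 1) p s) := by
  have hps0 : 0 < p * s := by positivity
  set β := (p * s - 1) / p with hβ
  set q : ℝ := ((d + 1 : ℕ) : ℝ) + p * s with hq
  have hqd : q - d = 1 + p * s := by rw [hq]; push_cast; ring
  have hm := measurable_shearWeight (d := d) p s
  rw [lintegral_halfSpace_eq_lintegral_joinLast (by fun_prop)]
  set h : ℝ → ℝ≥0∞ := fun t => ENNReal.ofReal (|1 - t ^ β| ^ p * |t - 1| ^ (-(1 + p * s))) with hh
  have hhm : Measurable h := by fun_prop
  set K : ℝ := Real.pi ^ ((d : ℝ) / 2) * (Real.Gamma ((1 + p * s) / 2) / Real.Gamma (q / 2)) with hK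
  have hK0 : 0 ≤ K := by
    have := Real.pi_pos
    have := Real.Gamma_pos_of_pos (by positivity : 0 < (1 + p * s) / 2)
    have := Real.Gamma_pos_of_pos (by positivity : 0 < q / 2)
    positivity
  have h1 : ∀ t : ℝ, t ≠ 1 → ∫⁻ z : EuclideanSpace ℝ (Fin d), shearWeight d p s (joinLast t z) *
      ENNReal.ofReal (|1 - joinLast t z (Fin.last d) ^ β| ^ p) = ENNReal.ofReal K * h t := by
    intro t ht
    have ht' : 0 < |t - 1| := abs_pos.2 (sub_ne_zero.2 ht)
    simp_rw [joinLast_last]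
    rw [lintegral_mul_const _ (by fun_prop)]
    have hw : ∀ z : EuclideanSpace ℝ (Fin d), shearWeight d p s (joinLast t z) =
        ENNReal.ofReal ((‖z‖ ^ 2 + |t - 1| ^ 2) ^ (-(q / 2))) := by
      intro z
      rw [shearWeight, joinLast_sub_unitPoint, sq_abs, ← norm_joinLast_sq, ← Real.rpow_natCast _ 2,
        ← Real.rpow_mul (norm_nonneg _)]
      congr 2; rw [hq]; push_cast; ring
    simp_rw [hw]
    rw [lintegral_norm_sq_add_sq_rpow (by linarith) ht', hqd,
      ← ENNReal.ofReal_mul (by positivity), hh, ← ENNReal.ofReal_mul hK0,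
      show (d : ℝ) - q = -(1 + p * s) by linarith]
    congr 1; ring
  have hae : ∀ᵐ t : ℝ, t ≠ 1 := compl_mem_ae_iff.2 (measure_singleton (1 : ℝ))
  have h2 : ∫⁻ t in Ioi (0 : ℝ), h t = 2 * ∫⁻ t in Ioo (0 : ℝ) 1, h t := by
    rw [← Ioc_union_Ioi_eq_Ioi zero_le_one, lintegral_union measurableSet_Ioi
      (Set.disjoint_left.2 fun x hx hx' => absurd hx.2 (not_le.2 hx')),
      lintegral_Ioi_one_eq hp, setLIntegral_congr Ioo_ae_eq_Ioc.symm, two_mul]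
  have h3 : ∫⁻ t in Ioo (0 : ℝ) 1, h t = ENNReal.ofReal (∫ r in (0 : ℝ)..1, constIntegrand p s r) := by
    have hi := intervalIntegrable_constIntegrand hp hs0 hs1
    rw [intervalIntegrable_iff_integrableOn_Ioo_of_le zero_le_one] at hi
    rw [intervalIntegral.integral_of_le zero_le_one, integral_Ioc_eq_integral_Ioo,
      ofReal_integral_eq_lintegral_ofReal hi]
    · refine setLIntegral_congr_fun measurableSet_Ioo fun t ht => ?_
      have : 0 < 1 - t := by linarith [ht.2]
      simp only [hh, constIntegrand]
      rw [abs_sub_comm t 1, abs_of_pos this, Real.rpow_neg this.le, div_eq_mul_inv]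
    · filter_upwards [ae_restrict_mem measurableSet_Ioo] with t ht
      have : 0 < 1 - t := by linarith [ht.2]
      simp only [Pi.zero_apply, constIntegrand]
      positivity
  rw [lintegral_congr_ae (ae_restrict_of_ae (hae.mono h1)), lintegral_const_mul _ hhm, h2, h3,
    ← ENNReal.ofReal_ofNat, ← ENNReal.ofReal_mul (by norm_num), ← ENNReal.ofReal_mul hK0]
  congr 1
  rw [hardyConst, hK, hq]
  push_cast
  rw [add_sub_cancel_right]
  ring

lemma hardyConst_pos {N : ℕ} {p s : ℝ} (hp : 1 ≤ p) (hs0 : 0 < s) (hs1 : s < 1)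
    (hps : p * s ≠ 1) : 0 < hardyConst N p s := by
  have hps0 : 0 < p * s := by positivity
  have hp0 : 0 < p := by linarith
  have := Real.pi_pos
  have := Real.Gamma_pos_of_pos (by positivity : 0 < (1 + p * s) / 2)
  have := Real.Gamma_pos_of_pos (by positivity : 0 < ((N : ℝ) + p * s) / 2)
  have : 0 < ∫ r in (0 : ℝ)..1, constIntegrand p s r := by
    refine intervalIntegral.intervalIntegral_pos_of_pos_on
      (intervalIntegrable_constIntegrand hp hs0 hs1) (fun r hr => ?_) one_pos
    have h1 : 0 < 1 - r := by linarith [hr.2]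
    have h2 : 1 - r ^ ((p * s - 1) / p) ≠ 0 := by
      intro h
      have h3 : r ^ ((p * s - 1) / p) = 1 := by linarith
      have h4 := Real.log_rpow hr.1 ((p * s - 1) / p)
      rw [h3, Real.log_one, eq_comm, mul_eq_zero] at h4
      replace h3 := h4.resolve_right (Real.log_neg hr.1 hr.2).ne
      rw [div_eq_zero_iff] at h3
      rcases h3 with h3 | h3
      · exact hps (by linarith)
      · exact hp0.ne' h3
    unfold constIntegrand
    have := abs_pos.2 h2
    positivity
  unfold hardyConst
  positivity

end Constant

/-! ### The inequality -/

section Inequality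

variable {d : ℕ} {𝕜 : Type*} [RCLike 𝕜]

instance (q : ℝ) : SFinite (hardyMeasure d q) := by
  unfold hardyMeasure; infer_instance

/-- The `p`-th power of the distance in `L^p(x_N ^ (-p s) dx)` between a function and its
translate. -/
noncomputable def shearDist (p s : ℝ) (u : Space d → 𝕜) (η : Space d) : ℝ≥0∞ :=
  ∫⁻ x, ENNReal.ofReal (‖u x - u (shear η x)‖ ^ p) ∂(hardyMeasure d (p * s))

lemma measurable_shearDist {p s : ℝ} {u : Space d → 𝕜} (hu : Measurable u) :
    Measurable (shearDist p s u) := by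
  unfold shearDist
  have h : Measurable fun z : Space d × Space d => u (shear z.1 z.2) := hu.comp (by fun_prop)
  exact Measurable.lintegral_prod_right' (f := fun z : Space d × Space d =>
    ENNReal.ofReal (‖u z.2 - u (shear z.1 z.2)‖ ^ p)) (by fun_prop)

lemma lintegral_rpow_norm_comp_shear {p s : ℝ} (hp : 1 ≤ p) {u : Space d → 𝕜} (hu : Measurable u)
    {η : Space d} (hη : η ∈ halfSpace d) :
    ∫⁻ x, ENNReal.ofReal (‖u (shear η x)‖ ^ p) ∂(hardyMeasure d (p * s)) =
      ENNReal.ofReal ((η (Fin.last d) ^ ((p * s - 1) / p)) ^ p) *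
        ∫⁻ x, ENNReal.ofReal (‖u x‖ ^ p) ∂(hardyMeasure d (p * s)) := by
  have hp0 : p ≠ 0 := by positivity
  have hη' : 0 < η (Fin.last d) := hη
  rw [lintegral_hardyMeasure_comp_shear (p * s) hη
    (f := fun x => ENNReal.ofReal (‖u x‖ ^ p)) (by fun_prop), ← Real.rpow_mul hη'.le,
    div_mul_cancel₀ _ hp0]

/-- Hyperplanes `x_N = c` are null sets. -/
lemma ae_last_ne (c : ℝ) : ∀ᵐ x : Space d, x (Fin.last d) ≠ c := by
  have hm : MeasurableSet {x : Space d | x (Fin.last d) ≠ c} :=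
    (measurableSet_eq_fun (by fun_prop) measurable_const).compl
  rw [← measurePreserving_joinLast.map_eq, ae_map_iff (by fun_prop) hm]
  simp only [joinLast_last]
  exact Measure.quasiMeasurePreserving_fst.ae (compl_mem_ae_iff.2 (measure_singleton c))

section Measurable

variable {p s : ℝ} {u : Space d → 𝕜}

lemma shearDist_ge (hp : 1 ≤ p) (hu : Measurable u) (hH : hardyTerm d p s u ≠ ⊤)
    {η : Space d} (hη : η ∈ halfSpace d) :
    ENNReal.ofReal (|1 - η (Fin.last d) ^ ((p * s - 1) / p)| ^ p) * hardyTerm d p s u ≤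
      shearDist p s u η := by
  rw [hardyTerm_eq hu] at hH ⊢
  have hus : Measurable fun x => u (shear η x) := hu.comp (by fun_prop)
  exact (lintegral_rpow_norm_sub_ge hp (Real.rpow_pos_of_pos hη _) hu hus hH
    (lintegral_rpow_norm_comp_shear hp hu hη)).1

lemma ofReal_hardyConst_mul (hp : 1 ≤ p) (hs0 : 0 < s) (hs1 : s < 1) (A : ℝ≥0∞) :
    ENNReal.ofReal (hardyConst (d + 1) p s) * A =
      ∫⁻ η in halfSpace d, shearWeight d p s η *
        (ENNReal.ofReal (|1 - η (Fin.last d) ^ ((p * s - 1) / p)| ^ p) * A) := by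
  have hm := measurable_shearWeight (d := d) p s
  rw [← lintegral_shearWeight_mul hp hs0 hs1, ← lintegral_mul_const _ (by fun_prop)]
  simp_rw [mul_assoc]

theorem hardyConst_mul_hardyTerm_le (hp : 1 ≤ p) (hs0 : 0 < s) (hs1 : s < 1)
    (hu : Measurable u) (hH : hardyTerm d p s u ≠ ⊤) :
    ENNReal.ofReal (hardyConst (d + 1) p s) * hardyTerm d p s u ≤ gagliardo d p s u := by
  rw [ofReal_hardyConst_mul hp hs0 hs1, gagliardo_eq hu]
  refine setLIntegral_mono' measurableSet_halfSpace fun η hη => ?_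
  exact mul_le_mul_right (shearDist_ge hp hu hH hη) _

/-! ### Equality holds for almost every translation -/

lemma ae_shearDist_eq (hp : 1 ≤ p) (hs0 : 0 < s) (hs1 : s < 1)
    (hu : Measurable u) (hH : hardyTerm d p s u ≠ ⊤)
    (heq : gagliardo d p s u = ENNReal.ofReal (hardyConst (d + 1) p s) * hardyTerm d p s u) :
    ∀ᵐ η ∂(volume.restrict (halfSpace d)), shearDist p s u η =
      ENNReal.ofReal (|1 - η (Fin.last d) ^ ((p * s - 1) / p)| ^ p) * hardyTerm d p s u := by
  have hfin : ENNReal.ofReal (hardyConst (d + 1) p s) * hardyTerm d p s u ≠ ⊤ :=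
    ENNReal.mul_ne_top ENNReal.ofReal_ne_top hH
  have h := ae_eq_of_ae_le_of_lintegral_le (μ := volume.restrict (halfSpace d))
    (f := fun η => shearWeight d p s η *
      (ENNReal.ofReal (|1 - η (Fin.last d) ^ ((p * s - 1) / p)| ^ p) * hardyTerm d p s u))
    (g := fun η => shearWeight d p s η * shearDist p s u η)
    (by
      filter_upwards [ae_restrict_mem measurableSet_halfSpace] with η hη
      exact mul_le_mul_right (shearDist_ge hp hu hH hη) _)
    (by rwa [← ofReal_hardyConst_mul hp hs0 hs1])
    ((measurable_shearWeight p s).mul (measurable_shearDist hu)).aemeasurable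
    (by
      rw [← ofReal_hardyConst_mul hp hs0 hs1, ← heq, gagliardo_eq hu]
      rfl)
  have hne : ∀ᵐ η ∂(volume.restrict (halfSpace d)), η ≠ unitPoint d :=
    ae_restrict_of_ae (compl_mem_ae_iff.2 (measure_singleton _))
  filter_upwards [h, hne] with η hη hne
  have hw : shearWeight d p s η ≠ 0 := by
    have : 0 < ‖η - unitPoint d‖ := norm_pos_iff.2 (sub_ne_zero.2 hne)
    have := Real.rpow_pos_of_pos this (-(((d + 1 : ℕ) : ℝ) + p * s))
    simpa [shearWeight] using this
  exact ((ENNReal.mul_right_inj hw ENNReal.ofReal_ne_top).1 hη).symm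

/-- For `p > 1`, equality forces `u(y) = (y_N / x_N) ^ ((p s - 1) / p) u(x)` for almost all pairs. -/
lemma ae_pair_of_eq_of_one_lt (hp : 1 < p) (hs0 : 0 < s) (hs1 : s < 1)
    (hu : Measurable u) (hH : hardyTerm d p s u ≠ ⊤)
    (heq : gagliardo d p s u = ENNReal.ofReal (hardyConst (d + 1) p s) * hardyTerm d p s u) :
    ∀ᵐ z ∂((volume.restrict (halfSpace d)).prod (volume.restrict (halfSpace d))),
      u z.2 = (z.2 (Fin.last d) / z.1 (Fin.last d)) ^ ((p * s - 1) / p) • u z.1 := by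
  refine ae_prod_halfSpace_of_ae_shear (P := {z | u z.2 =
    (z.2 (Fin.last d) / z.1 (Fin.last d)) ^ ((p * s - 1) / p) • u z.1})
    (measurableSet_eq_fun (by fun_prop) (by fun_prop)) ?_
  filter_upwards [ae_shearDist_eq hp.le hs0 hs1 hu hH heq,
    ae_restrict_mem measurableSet_halfSpace] with η hη hηm
  have hus : Measurable fun x => u (shear η x) := hu.comp (by fun_prop)
  rw [hardyTerm_eq hu] at hH hη
  have h := ((lintegral_rpow_norm_sub_ge hp.le (Real.rpow_pos_of_pos hηm _) hu hus hH
    (lintegral_rpow_norm_comp_shear hp.le hu hηm)).2 hη).1 hp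
  rw [ae_hardyMeasure] at h
  filter_upwards [h, ae_restrict_mem measurableSet_halfSpace] with x hx hxm
  have hxm' : 0 < x (Fin.last d) := hxm
  simp only [shear_apply_last]
  rw [hx, mul_div_cancel_left₀ _ hxm'.ne']

/-- The pairs of points such that the value of `u` at the upper point lies on the segment from
the origin to the value at the lower point. -/
def segmentPairs (u : Space d → 𝕜) : Set (Space d × Space d) :=
  {z | (z.2 (Fin.last d) < z.1 (Fin.last d) → ‖u z.2‖ = ‖u z.1‖ + ‖u z.1 - u z.2‖) ∧
    (z.1 (Fin.last d) < z.2 (Fin.last d) → ‖u z.1‖ = ‖u z.2‖ + ‖u z.1 - u z.2‖)}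

lemma measurableSet_segmentPairs (hu : Measurable u) : MeasurableSet (segmentPairs u) := by
  have h1 : MeasurableSet {z : Space d × Space d | z.2 (Fin.last d) < z.1 (Fin.last d)} :=
    measurableSet_lt (by fun_prop) (by fun_prop)
  have h2 : MeasurableSet {z : Space d × Space d | z.1 (Fin.last d) < z.2 (Fin.last d)} :=
    measurableSet_lt (by fun_prop) (by fun_prop)
  have h3 : MeasurableSet {z : Space d × Space d | ‖u z.2‖ = ‖u z.1‖ + ‖u z.1 - u z.2‖} :=
    measurableSet_eq_fun (by fun_prop) (by fun_prop)
  have h4 : MeasurableSet {z : Space d × Space d | ‖u z.1‖ = ‖u z.2‖ + ‖u z.1 - u z.2‖} :=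
    measurableSet_eq_fun (by fun_prop) (by fun_prop)
  exact (h1.imp h3).inter (h2.imp h4)

lemma one_lt_rpow_iff_of_neg {t β : ℝ} (ht : 0 < t) (hβ : β < 0) : 1 < t ^ β ↔ t < 1 := by
  conv_lhs => rw [← Real.one_rpow β]
  exact Real.rpow_lt_rpow_iff_of_neg one_pos ht hβ

lemma rpow_lt_one_iff_of_neg {t β : ℝ} (ht : 0 < t) (hβ : β < 0) : t ^ β < 1 ↔ 1 < t := by
  conv_lhs => rw [← Real.one_rpow β]
  exact Real.rpow_lt_rpow_iff_of_neg ht one_pos hβ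

lemma ae_segmentPairs_of_eq (hs0 : 0 < s) (hs1 : s < 1)
    (hu : Measurable u) (hH : hardyTerm d 1 s u ≠ ⊤)
    (heq : gagliardo d 1 s u = ENNReal.ofReal (hardyConst (d + 1) 1 s) * hardyTerm d 1 s u) :
    ∀ᵐ z ∂((volume.restrict (halfSpace d)).prod (volume.restrict (halfSpace d))),
      z ∈ segmentPairs u := by
  refine ae_prod_halfSpace_of_ae_shear (measurableSet_segmentPairs hu) ?_
  filter_upwards [ae_shearDist_eq le_rfl hs0 hs1 hu hH heq,
    ae_restrict_mem measurableSet_halfSpace] with η hη hηm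
  have hus : Measurable fun x => u (shear η x) := hu.comp (by fun_prop)
  rw [hardyTerm_eq hu] at hH hη
  have h := ((lintegral_rpow_norm_sub_ge le_rfl (Real.rpow_pos_of_pos hηm _) hu hus hH
    (lintegral_rpow_norm_comp_shear le_rfl hu hηm)).2 hη).2 rfl
  rw [ae_hardyMeasure] at h
  have hβ : (1 * s - 1) / 1 < 0 := by linarith
  filter_upwards [h, ae_restrict_mem measurableSet_halfSpace] with x hx hxm
  have hxm' : 0 < x (Fin.last d) := hxm
  rw [rpow_lt_one_iff_of_neg hηm hβ, one_lt_rpow_iff_of_neg hηm hβ] at hx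
  simp only [segmentPairs, mem_ofPred_eq, shear_apply_last]
  exact ⟨fun h => hx.2 (by nlinarith), fun h => hx.1 (by nlinarith)⟩

/-- The converse of `ae_segmentPairs_of_eq`, by integrating the pointwise identities. -/
lemma gagliardo_eq_of_ae_segmentPairs (hs0 : 0 < s) (hs1 : s < 1)
    (hu : Measurable u) (hH : hardyTerm d 1 s u ≠ ⊤)
    (h : ∀ η ∈ halfSpace d, ∀ᵐ x ∂(volume.restrict (halfSpace d)),
      (x, shear η x) ∈ segmentPairs u) :
    gagliardo d 1 s u = ENNReal.ofReal (hardyConst (d + 1) 1 s) * hardyTerm d 1 s u := by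
  have hβ : (1 * s - 1) / 1 < 0 := by linarith
  rw [ofReal_hardyConst_mul le_rfl hs0 hs1, gagliardo_eq hu]
  refine lintegral_congr_ae ?_
  filter_upwards [ae_restrict_mem measurableSet_halfSpace, ae_restrict_of_ae (ae_last_ne 1)]
    with η hη hη1
  have hus : Measurable fun x => u (shear η x) := hu.comp (by fun_prop)
  congr 1
  have hscale := lintegral_rpow_norm_comp_shear (s := s) le_rfl hu hη
  rw [hardyTerm_eq hu] at hH ⊢
  set ρ := η (Fin.last d) ^ ((1 * s - 1) / 1) with hρ
  have hρ0 : 0 < ρ := Real.rpow_pos_of_pos hη _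
  have hae := ae_hardyMeasure (q := 1 * s).2 (h η hη)
  have hpos : ∀ᵐ x ∂(hardyMeasure d (1 * s)), x ∈ halfSpace d :=
    ae_hardyMeasure.2 (ae_restrict_mem measurableSet_halfSpace)
  simp only [Real.rpow_one] at hscale hH ⊢
  set A := ∫⁻ x, ENNReal.ofReal ‖u x‖ ∂(hardyMeasure d (1 * s)) with hA
  set F := ∫⁻ x, ENNReal.ofReal ‖u x - u (shear η x)‖ ∂(hardyMeasure d (1 * s)) with hF
  have hadd : ∀ f : Space d → 𝕜, Measurable f →
      ∫⁻ x, ENNReal.ofReal (‖f x‖ + ‖u x - u (shear η x)‖) ∂(hardyMeasure d (1 * s)) =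
      ∫⁻ x, ENNReal.ofReal ‖f x‖ ∂(hardyMeasure d (1 * s)) + F := by
    intro f hf
    rw [hF, ← lintegral_add_left (by fun_prop)]
    exact lintegral_congr fun x => ENNReal.ofReal_add (norm_nonneg _) (norm_nonneg _)
  rcases lt_trichotomy (η (Fin.last d)) 1 with h1 | h1 | h1
  · have hρ1 : 1 < ρ := (one_lt_rpow_iff_of_neg hη hβ).2 h1
    have hB : ENNReal.ofReal ρ * A = A + F := by
      rw [← hscale, hA, ← hadd u hu]
      refine lintegral_congr_ae ?_
      filter_upwards [hae, hpos] with x hx hxm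
      have hxm' : 0 < x (Fin.last d) := hxm
      rw [← hx.1 (by simp only [shear_apply_last]; nlinarith)]
    have hs : ENNReal.ofReal ρ * A = A + ENNReal.ofReal (ρ - 1) * A := by
      nth_rewrite 2 [← one_mul A]
      rw [← add_mul, ← ENNReal.ofReal_one, ← ENNReal.ofReal_add zero_le_one (by linarith)]
      congr 2; ring
    rw [hs] at hB
    rw [abs_sub_comm, abs_of_pos (by linarith : 0 < ρ - 1)]
    exact ((ENNReal.add_right_inj hH).1 hB).symm
  · exact absurd h1 hη1
  · have hρ1 : ρ < 1 := (rpow_lt_one_iff_of_neg hη hβ).2 h1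
    have hB : A = ENNReal.ofReal ρ * A + F := by
      rw [← hscale, ← hadd _ hus, hA]
      refine lintegral_congr_ae ?_
      filter_upwards [hae, hpos] with x hx hxm
      have hxm' : 0 < x (Fin.last d) := hxm
      rw [← hx.2 (by simp only [shear_apply_last]; nlinarith)]
    have hs : A = ENNReal.ofReal ρ * A + ENNReal.ofReal (1 - ρ) * A := by
      rw [← add_mul, ← ENNReal.ofReal_add hρ0.le (by linarith)]
      simp
    rw [abs_of_pos (by linarith : 0 < 1 - ρ)]
    have hρA : ENNReal.ofReal ρ * A ≠ ⊤ := ENNReal.mul_ne_top ENNReal.ofReal_ne_top hH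
    refine ((ENNReal.add_right_inj hρA).1 (hs.symm.trans hB)).symm

end Measurable

end Inequality

/-! ### Functions attaining equality -/

section EqualityCases

variable {d : ℕ} {𝕜 : Type*} [RCLike 𝕜]

lemma lintegral_halfSpace_last {G : ℝ → ℝ≥0∞} (hG : Measurable G) :
    ∫⁻ x in halfSpace d, G (x (Fin.last d)) =
      (∫⁻ t in Ioi (0 : ℝ), G t) * volume (univ : Set (EuclideanSpace ℝ (Fin d))) := by
  rw [lintegral_halfSpace_eq_lintegral_joinLast (f := fun x => G (x (Fin.last d))) (by fun_prop)]
  simp_rw [joinLast_last, lintegral_const]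
  rw [lintegral_mul_const _ hG]

instance : NeZero (volume.restrict (halfSpace d)) := by
  refine ⟨fun h => ?_⟩
  rw [Measure.restrict_eq_zero] at h
  exact (isOpen_halfSpace.measure_pos volume ⟨unitPoint d, by simp [mem_halfSpace]⟩).ne' h

lemma lintegral_halfSpace_inv_last :
    ∫⁻ x in halfSpace d, ENNReal.ofReal (x (Fin.last d))⁻¹ = ⊤ := by
  rw [lintegral_halfSpace_last (G := fun t => ENNReal.ofReal t⁻¹) (by fun_prop)]
  have h : ∫⁻ t in Ioi (0 : ℝ), ENNReal.ofReal t⁻¹ = ⊤ := by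
    by_contra h
    rw [← ne_eq, lintegral_ofReal_ne_top_iff_integrable (by fun_prop)] at h
    · exact not_integrableOn_Ioi_inv h
    · filter_upwards [ae_restrict_mem measurableSet_Ioi] with t ht
      have : (0 : ℝ) < t := ht
      positivity
  have h' : volume (univ : Set (EuclideanSpace ℝ (Fin d))) ≠ 0 := by
    simp [NeZero.ne]
  rw [h, ENNReal.top_mul h']

lemma ae_eq_zero_of_hardyTerm_eq_zero {p s : ℝ} (hp : 1 ≤ p) {u : Space d → 𝕜} (hu : Measurable u)
    (h : hardyTerm d p s u = 0) : ∀ᵐ x ∂(volume.restrict (halfSpace d)), u x = 0 := by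
  have hp0 : p ≠ 0 := by positivity
  rw [hardyTerm_eq hu, lintegral_eq_zero_iff (by fun_prop), EventuallyEq, ae_hardyMeasure] at h
  filter_upwards [h] with x hx
  have h0 : ‖u x‖ ^ p = 0 := le_antisymm (ENNReal.ofReal_eq_zero.1 hx) (by positivity)
  rwa [Real.rpow_eq_zero (norm_nonneg _) hp0, norm_eq_zero] at h0

/-- A multiple of the virtual ground state `x_N ^ ((p s - 1) / p)` has infinite Hardy term, so for
`p > 1` equality is not attained. -/
theorem ae_eq_zero_of_eq_of_one_lt {p s : ℝ} {u : Space d → 𝕜} (hp : 1 < p) (hs0 : 0 < s)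
    (hs1 : s < 1) (hu : Measurable u) (hH : hardyTerm d p s u ≠ ⊤)
    (heq : gagliardo d p s u = ENNReal.ofReal (hardyConst (d + 1) p s) * hardyTerm d p s u) :
    ∀ᵐ x ∂(volume.restrict (halfSpace d)), u x = 0 := by
  have hp0 : p ≠ 0 := by positivity
  obtain ⟨x, hx, hxm⟩ := ((Measure.ae_ae_of_ae_prod
    (ae_pair_of_eq_of_one_lt hp hs0 hs1 hu hH heq)).and
    (ae_restrict_mem measurableSet_halfSpace)).exists
  have hxm' : 0 < x (Fin.last d) := hxm
  by_cases h0 : u x = 0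
  · filter_upwards [hx] with y hy
    rw [hy, h0, smul_zero]
  · refine absurd ?_ hH
    set k : ℝ := x (Fin.last d) ^ (1 - p * s) * ‖u x‖ ^ p with hk
    have hk0 : 0 < k := by
      have := norm_pos_iff.2 h0
      positivity
    have h1 : hardyTerm d p s u = ∫⁻ y in halfSpace d,
        ENNReal.ofReal k * ENNReal.ofReal (y (Fin.last d))⁻¹ := by
      refine lintegral_congr_ae ?_
      filter_upwards [hx, ae_restrict_mem measurableSet_halfSpace] with y hy hym
      have hym' : 0 < y (Fin.last d) := hym
      rw [← ENNReal.ofReal_mul hk0.le]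
      congr 1
      have hne : x (Fin.last d) ^ (p * s - 1) ≠ 0 := by positivity
      have hne' : y (Fin.last d) ^ (p * s) ≠ 0 := by positivity
      rw [hy, norm_smul, Real.norm_of_nonneg (by positivity), Real.mul_rpow (by positivity)
        (norm_nonneg _), ← Real.rpow_mul (by positivity), div_mul_cancel₀ _ hp0,
        Real.div_rpow hym'.le hxm'.le, hk, Real.rpow_sub_one hym'.ne',
        ← neg_sub (p * s) 1, Real.rpow_neg hxm'.le]
      field_simp
    rw [h1, lintegral_const_mul _ (by fun_prop), lintegral_halfSpace_inv_last]
    exact ENNReal.mul_top (by simpa using hk0)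

/-- A set that lies almost nowhere below each of its points is a null set. -/
lemma measure_eq_zero_of_below_null {A : Set (Space d)}
    (h : ∀ x ∈ A, volume (A ∩ {y | y (Fin.last d) < x (Fin.last d)}) = 0) : volume A = 0 := by
  set B : Set (Space d) := {x ∈ A | ∃ y ∈ A, x (Fin.last d) < y (Fin.last d)} with hB
  have hB0 : volume B = 0 := by
    refine measure_null_of_locally_null B fun x hx => ?_
    obtain ⟨hxA, y, hyA, hxy⟩ := hx
    refine ⟨B ∩ {z | z (Fin.last d) < y (Fin.last d)}, ?_, ?_⟩
    · refine inter_mem_nhdsWithin B ?_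
      exact (isOpen_lt continuous_last continuous_const).mem_nhds hxy
    · refine measure_mono_null ?_ (h y hyA)
      exact inter_subset_inter_left _ fun z hz => hz.1
  have hC0 : volume (A \ B) = 0 := by
    rcases (A \ B).eq_empty_or_nonempty with he | ⟨x, hx⟩
    · simp [he]
    · refine measure_mono_null (fun z hz => ?_) (ae_last_ne (d := d) (x (Fin.last d)))
      have h1 : ¬ x (Fin.last d) < z (Fin.last d) := fun hlt => hx.2 ⟨hx.1, z, hz.1, hlt⟩
      have h2 : ¬ z (Fin.last d) < x (Fin.last d) := fun hlt => hz.2 ⟨hz.1, x, hx.1, hlt⟩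
      exact fun hne => hne (le_antisymm (not_lt.1 h1) (not_lt.1 h2))
  refine measure_mono_null (t := B ∪ A \ B) (fun z hz => ?_) (measure_union_null hB0 hC0)
  by_cases hzB : z ∈ B
  · exact Or.inl hzB
  · exact Or.inr ⟨hz, hzB⟩

/-- The essential infimum of `|u|` over the slab `0 < y_N < t`. -/
noncomputable def slabInf (u : Space d → 𝕜) (t : ℝ) : ℝ≥0∞ :=
  essInf (fun y => ‖u y‖ₑ) ((volume.restrict (halfSpace d)).restrict {y | y (Fin.last d) < t})

lemma measurableSet_last_lt (t : ℝ) : MeasurableSet {y : Space d | y (Fin.last d) < t} :=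
  measurableSet_lt (by fun_prop) measurable_const

lemma antitone_slabInf (u : Space d → 𝕜) : Antitone (slabInf u) := by
  intro t t' h
  have hsub : {y : Space d | y (Fin.last d) < t} ⊆ {y | y (Fin.last d) < t'} :=
    fun y hy => lt_of_lt_of_le hy h
  exact essInf_antitone_measure (Measure.restrict_mono hsub le_rfl).absolutelyContinuous

lemma ae_slabInf_le (u : Space d → 𝕜) (t : ℝ) :
    ∀ᵐ y ∂(volume.restrict (halfSpace d)), y (Fin.last d) < t → slabInf u t ≤ ‖u y‖ₑ :=
  (ae_restrict_iff' (measurableSet_last_lt t)).1 (ae_essInf_le (f := fun y => ‖u y‖ₑ))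

lemma slabInf_ne_top (u : Space d → 𝕜) {t : ℝ} (ht : 0 < t) : slabInf u t ≠ ⊤ := by
  intro htop
  have h := ae_slabInf_le u t
  rw [htop] at h
  have h0 : volume.restrict (halfSpace d) {y : Space d | y (Fin.last d) < t} = 0 := by
    refine measure_mono_null (fun y hy => ?_) h
    simp only [mem_compl_iff, mem_ofPred_eq]
    intro hy'
    exact absurd (hy' hy) (by simp)
  rw [Measure.restrict_apply (measurableSet_last_lt t)] at h0
  refine (((isOpen_lt continuous_last continuous_const).inter isOpen_halfSpace).measure_pos
    volume ⟨(t / 2) • unitPoint d, ?_, ?_⟩).ne' h0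
  · simp [ht]
  · simp [mem_halfSpace, ht]

/-- If the values of `u` at almost all pairs are ordered along segments, then `|u|` agrees almost
everywhere with a non-increasing function of the last coordinate. -/
lemma enorm_ae_eq_slabInf {u : Space d → 𝕜}
    (h : ∀ᵐ z ∂((volume.restrict (halfSpace d)).prod (volume.restrict (halfSpace d))),
      z ∈ segmentPairs u) :
    ∀ᵐ x ∂(volume.restrict (halfSpace d)), ‖u x‖ₑ = slabInf u (x (Fin.last d)) := by
  have hle : ∀ᵐ x ∂(volume.restrict (halfSpace d)), ‖u x‖ₑ ≤ slabInf u (x (Fin.last d)) := by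
    filter_upwards [Measure.ae_ae_of_ae_prod h] with x hx
    refine le_essInf_of_ae_le _ ?_
    refine (ae_restrict_iff' (measurableSet_last_lt _)).2 ?_
    filter_upwards [hx] with y hy hyx
    have h1 := hy.1 hyx
    rw [enorm_le_iff_norm_le]
    linarith [norm_nonneg (u x - u y)]
  have hlt : ∀ c : ℝ≥0∞, ∀ᵐ x ∂(volume.restrict (halfSpace d)),
      ¬ (‖u x‖ₑ < c ∧ c < slabInf u (x (Fin.last d))) := by
    intro c
    rw [ae_restrict_iff' measurableSet_halfSpace]
    have h0 : volume {x : Space d | x ∈ halfSpace d ∧ ‖u x‖ₑ < c ∧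
        c < slabInf u (x (Fin.last d))} = 0 := by
      refine measure_eq_zero_of_below_null fun x hx => ?_
      have h1 := (ae_restrict_iff' measurableSet_halfSpace).1 (ae_slabInf_le u (x (Fin.last d)))
      refine measure_mono_null (fun y hy => ?_) h1
      intro hcon
      exact absurd (hx.2.2.trans_le (hcon hy.1.1 hy.2)) (not_lt.2 hy.1.2.1.le)
    refine measure_mono_null (fun x hx => ?_) h0
    by_contra hn
    exact hx fun hxm hh => hn ⟨hxm, hh⟩
  have hlt' : ∀ᵐ x ∂(volume.restrict (halfSpace d)), ∀ q : ℚ,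
      ¬ (‖u x‖ₑ < ((q : ℝ).toNNReal : ℝ≥0∞) ∧
        ((q : ℝ).toNNReal : ℝ≥0∞) < slabInf u (x (Fin.last d))) :=
    ae_all_iff.2 fun q => hlt _
  filter_upwards [hle, hlt'] with x hx1 hx2
  refine le_antisymm hx1 (not_lt.1 fun hcon => ?_)
  obtain ⟨q, -, hq⟩ := ENNReal.lt_iff_exists_rat_btwn.1 hcon
  exact hx2 q hq

/-- In dimension `N ≥ 2` a nonzero function whose modulus depends on the last coordinate only has
infinite Hardy term, so for `p = 1` equality is not attained. -/
theorem ae_eq_zero_of_eq_of_one_le_dim {s : ℝ} {u : Space d → 𝕜} (hd : 1 ≤ d) (hs0 : 0 < s)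
    (hs1 : s < 1) (hu : Measurable u) (hH : hardyTerm d 1 s u ≠ ⊤)
    (heq : gagliardo d 1 s u = ENNReal.ofReal (hardyConst (d + 1) 1 s) * hardyTerm d 1 s u) :
    ∀ᵐ x ∂(volume.restrict (halfSpace d)), u x = 0 := by
  have hseg := enorm_ae_eq_slabInf (ae_segmentPairs_of_eq hs0 hs1 hu hH heq)
  refine ae_eq_zero_of_hardyTerm_eq_zero (s := s) le_rfl hu ?_
  have h1 : hardyTerm d 1 s u = ∫⁻ x in halfSpace d,
      ENNReal.ofReal (x (Fin.last d) ^ (-(1 * s))) * slabInf u (x (Fin.last d)) := by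
    rw [hardyTerm_eq hu, lintegral_hardyMeasure _ (by fun_prop)]
    refine lintegral_congr_ae ?_
    filter_upwards [hseg] with x hx
    rw [← hx, Real.rpow_one, ofReal_norm]
  have hm : Measurable (slabInf u) := (antitone_slabInf u).measurable
  rw [lintegral_halfSpace_last (G := fun t => ENNReal.ofReal (t ^ (-(1 * s))) * slabInf u t)
    (by fun_prop)] at h1
  have htop : volume (univ : Set (EuclideanSpace ℝ (Fin d))) = ⊤ := by
    obtain ⟨k, rfl⟩ : ∃ k, d = k + 1 := ⟨d - 1, by omega⟩
    have := NormedSpace.noncompactSpace ℝ (EuclideanSpace ℝ (Fin (k + 1)))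
    exact measure_univ_of_isAddLeftInvariant _
  rw [htop] at h1
  rw [h1] at hH ⊢
  have h0 : ∫⁻ t in Ioi (0 : ℝ), ENNReal.ofReal (t ^ (-(1 * s))) * slabInf u t = 0 := by
    by_contra hne
    exact hH (ENNReal.mul_top hne)
  rw [h0, zero_mul]

lemma sameRay_of_mem_segmentPairs {u : Space d → 𝕜} {x y : Space d}
    (h : (x, y) ∈ segmentPairs u) (hne : y (Fin.last d) ≠ x (Fin.last d)) :
    ‖u x‖ • u y = ‖u y‖ • u x := by
  rcases hne.lt_or_gt with hlt | hlt
  · have h1 := h.1 hlt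
    have h2 : SameRay ℝ (u x) (u y - u x) := by
      rw [sameRay_iff_norm_add, norm_sub_rev (u y), ← h1, add_sub_cancel]
    have h3 := (SameRay.rfl.add_right h2).norm_smul_eq
    rwa [add_sub_cancel] at h3
  · have h1 := h.2 hlt
    have h2 : SameRay ℝ (u y) (u x - u y) := by
      rw [sameRay_iff_norm_add, ← h1, add_sub_cancel]
    have h3 := (SameRay.rfl.add_right h2).norm_smul_eq
    rw [add_sub_cancel] at h3
    exact h3.symm

theorem exists_antitoneOn_of_eq {s : ℝ} {u : Space d → 𝕜} (hs0 : 0 < s)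
    (hs1 : s < 1) (hu : Measurable u) (hH : hardyTerm d 1 s u ≠ ⊤)
    (heq : gagliardo d 1 s u = ENNReal.ofReal (hardyConst (d + 1) 1 s) * hardyTerm d 1 s u) :
    ∃ (c : 𝕜) (g : ℝ → ℝ), AntitoneOn g (Ioi 0) ∧
      u =ᵐ[volume.restrict (halfSpace d)] fun x => c * (g (x (Fin.last d)) : 𝕜) := by
  have hpair := ae_segmentPairs_of_eq hs0 hs1 hu hH heq
  have hseg := enorm_ae_eq_slabInf hpair
  by_cases h0 : ∀ᵐ x ∂(volume.restrict (halfSpace d)), u x = 0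
  · refine ⟨0, 0, fun _ _ _ _ _ => le_rfl, ?_⟩
    filter_upwards [h0] with x hx
    simp [hx]
  · obtain ⟨x, hx0, hx⟩ := ((not_eventually.1 h0).and_eventually
      (Measure.ae_ae_of_ae_prod hpair)).exists
    refine ⟨‖u x‖⁻¹ • u x, fun t => (slabInf u t).toReal, fun t ht t' ht' htt => ?_, ?_⟩
    · exact ENNReal.toReal_mono (slabInf_ne_top u ht) (antitone_slabInf u htt)
    · filter_upwards [hx, hseg, ae_restrict_of_ae (ae_last_ne (x (Fin.last d)))] with y hy hy1 hy2
      have h1 := sameRay_of_mem_segmentPairs hy hy2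
      have hn : ‖u x‖ ≠ 0 := norm_ne_zero_iff.2 hx0
      rw [← hy1, toReal_enorm, mul_comm, ← RCLike.real_smul_eq_coe_mul, smul_comm, ← h1, smul_smul,
        inv_mul_cancel₀ hn, one_smul]

lemma ae_comp_shear {η : Space d} (hη : η ∈ halfSpace d) {P : Space d → Prop}
    (h : ∀ᵐ x ∂(volume.restrict (halfSpace d)), P x) :
    ∀ᵐ x ∂(volume.restrict (halfSpace d)), P (shear η x) := by
  obtain ⟨t, ht, htm, ht0⟩ := exists_measurable_superset_of_null h
  have h1 := lintegral_comp_shear hη (f := t.indicator 1) (measurable_one.indicator htm)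
  have hm : Measurable fun x => t.indicator (1 : Space d → ℝ≥0∞) (shear η x) :=
    (measurable_one.indicator htm).comp (by fun_prop)
  rw [lintegral_indicator_one htm, ht0, mul_zero, lintegral_eq_zero_iff hm] at h1
  filter_upwards [h1] with x hx
  by_contra hP
  have : shear η x ∈ t := ht hP
  simp [this] at hx

lemma norm_eq_add_of_le {c : 𝕜} {a b : ℝ} (hb : 0 ≤ b) (hab : b ≤ a) :
    ‖c * (a : 𝕜)‖ = ‖c * (b : 𝕜)‖ + ‖c * (a : 𝕜) - c * (b : 𝕜)‖ := by
  rw [← mul_sub, ← RCLike.ofReal_sub, norm_mul, norm_mul, norm_mul, RCLike.norm_ofReal,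
    RCLike.norm_ofReal, RCLike.norm_ofReal, abs_of_nonneg hb, abs_of_nonneg (hb.trans hab),
    abs_of_nonneg (sub_nonneg.2 hab)]
  ring

/-- A non-increasing function with finite Hardy term is nonnegative, since `x ^ (-s)` is not
integrable at infinity. -/
lemma nonneg_of_antitoneOn {s : ℝ} (hs1 : s < 1) {u : Space d → 𝕜} (hu : Measurable u)
    (hH : hardyTerm d 1 s u ≠ ⊤) {c : 𝕜} (hc : c ≠ 0) {g : ℝ → ℝ} (hg : AntitoneOn g (Ioi 0))
    (hug : u =ᵐ[volume.restrict (halfSpace d)] fun x => c * (g (x (Fin.last d)) : 𝕜))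
    {t : ℝ} (ht : 0 < t) : 0 ≤ g t := by
  by_contra hneg
  rw [not_le] at hneg
  refine hH (top_le_iff.1 ?_)
  set k := ‖c‖ * |g t| with hk
  have hk0 : 0 < k := mul_pos (norm_pos_iff.2 hc) (abs_pos.2 hneg.ne)
  set G : ℝ → ℝ≥0∞ := (Ioi t).indicator
    fun r => ENNReal.ofReal k * ENNReal.ofReal (r ^ (-s)) with hG
  have hGm : Measurable G := Measurable.indicator (by fun_prop) measurableSet_Ioi
  have h1 : ∫⁻ x in halfSpace d, G (x (Fin.last d)) ≤ hardyTerm d 1 s u := by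
    rw [hardyTerm_eq hu, lintegral_hardyMeasure _ (by fun_prop)]
    refine lintegral_mono_ae ?_
    filter_upwards [hug] with x hx
    by_cases hxt : t < x (Fin.last d)
    · rw [hG, indicator_of_mem (mem_Ioi.2 hxt), one_mul, Real.rpow_one, mul_comm]
      gcongr
      rw [hx, norm_mul, RCLike.norm_ofReal, hk]
      refine mul_le_mul_of_nonneg_left ?_ (norm_nonneg _)
      have h2 := hg (mem_Ioi.2 ht) (mem_Ioi.2 (ht.trans hxt)) hxt.le
      rw [abs_of_neg hneg, abs_of_nonpos (by linarith : g (x (Fin.last d)) ≤ 0)]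
      linarith
    · rw [hG, indicator_of_notMem (by simpa using hxt)]
      exact zero_le
  refine le_trans (top_le_iff.2 ?_) h1
  rw [lintegral_halfSpace_last hGm]
  have h3 : ∫⁻ r in Ioi (0 : ℝ), G r = ⊤ := by
    refine top_le_iff.1 (le_trans (top_le_iff.2 ?_)
      (lintegral_mono_set (Ioi_subset_Ioi ht.le) : ∫⁻ r in Ioi t, G r ≤ _))
    rw [setLIntegral_congr_fun (g := fun r => ENNReal.ofReal k * ENNReal.ofReal (r ^ (-s)))
      measurableSet_Ioi fun r hr => by simp only [hG]; rw [indicator_of_mem hr],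
      lintegral_const_mul _ (by fun_prop)]
    have h4 : ∫⁻ r in Ioi t, ENNReal.ofReal (r ^ (-s)) = ⊤ := by
      by_contra h
      rw [← ne_eq, lintegral_ofReal_ne_top_iff_integrable (by fun_prop)] at h
      · have := (integrableOn_Ioi_rpow_iff ht).1 h
        linarith
      · filter_upwards [ae_restrict_mem measurableSet_Ioi] with r hr
        have : (0 : ℝ) < r := ht.trans hr
        positivity
    rw [h4, ENNReal.mul_top (by simpa using hk0)]
  rw [h3, ENNReal.top_mul (by simp [NeZero.ne])]

theorem eq_of_antitoneOn {s : ℝ} {u : Space d → 𝕜} (hs0 : 0 < s)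
    (hs1 : s < 1) (hu : Measurable u) (hH : hardyTerm d 1 s u ≠ ⊤)
    {c : 𝕜} {g : ℝ → ℝ} (hg : AntitoneOn g (Ioi 0))
    (hug : u =ᵐ[volume.restrict (halfSpace d)] fun x => c * (g (x (Fin.last d)) : 𝕜)) :
    gagliardo d 1 s u = ENNReal.ofReal (hardyConst (d + 1) 1 s) * hardyTerm d 1 s u := by
  refine gagliardo_eq_of_ae_segmentPairs hs0 hs1 hu hH fun η hη => ?_
  filter_upwards [hug, ae_comp_shear hη hug, ae_restrict_mem measurableSet_halfSpace]
    with x hx hy hxm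
  have hym := (shear_mem_halfSpace hη).2 hxm
  simp only [segmentPairs, mem_ofPred_eq]
  rw [hx, hy]
  rcases eq_or_ne c 0 with rfl | hc
  · simp
  · have hx0 := nonneg_of_antitoneOn hs1 hu hH hc hg hug hxm
    have hy0 := nonneg_of_antitoneOn hs1 hu hH hc hg hug hym
    refine ⟨fun hlt => ?_, fun hlt => ?_⟩
    · rw [norm_sub_rev]
      exact norm_eq_add_of_le hx0 (hg hym hxm hlt.le)
    · exact norm_eq_add_of_le hy0 (hg hxm hym hlt.le)

end EqualityCases

/-! ### Finiteness of the functionals -/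

section Finiteness

variable {d : ℕ} {𝕜 : Type*} [RCLike 𝕜]

lemma integrable_min_one_norm_rpow {p s : ℝ} (hs0 : 0 < s) (hs1 : s < 1) (hp : 1 ≤ p) :
    Integrable fun h : Space d =>
      min 1 ‖h‖ ^ p * ‖h‖ ^ (-(((d + 1 : ℕ) : ℝ) + p * s)) := by
  have hps0 : 0 < p * s := by positivity
  have hps1 : p * s < p := by nlinarith
  rw [integrable_fun_norm_addHaar volume (f := fun y : ℝ =>
    min 1 y ^ p * y ^ (-(((d + 1 : ℕ) : ℝ) + p * s))), finrank_euclideanSpace_fin,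
    add_tsub_cancel_right, ← Ioc_union_Ioi_eq_Ioi zero_le_one]
  refine IntegrableOn.union ?_ ?_
  · have h : IntegrableOn (fun y : ℝ => y ^ (p - 1 - p * s)) (Ioc 0 1) := by
      rw [← intervalIntegrable_iff_integrableOn_Ioc_of_le zero_le_one]
      exact intervalIntegral.intervalIntegrable_rpow' (by linarith)
    refine h.congr_fun (fun y hy => ?_) measurableSet_Ioc
    have hy0 : 0 < y := hy.1
    simp only [smul_eq_mul]
    rw [min_eq_right hy.2, ← Real.rpow_natCast, ← Real.rpow_add hy0, ← Real.rpow_add hy0]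
    congr 1; push_cast; ring
  · have h : IntegrableOn (fun y : ℝ => y ^ (-1 - p * s)) (Ioi 1) :=
      integrableOn_Ioi_rpow_of_lt (by linarith) one_pos
    refine h.congr_fun (fun y hy => ?_) measurableSet_Ioi
    have hy1 : 1 < y := hy
    have hy0 : 0 < y := one_pos.trans hy1
    simp only [smul_eq_mul]
    rw [min_eq_left hy1.le, Real.one_rpow, one_mul, ← Real.rpow_natCast, ← Real.rpow_add hy0]
    congr 1; push_cast; ring

lemma lintegral_min_one_norm_rpow_ne_top {p s : ℝ} (hs0 : 0 < s) (hs1 : s < 1) (hp : 1 ≤ p) :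
    ∫⁻ h : Space d, ENNReal.ofReal
      (min 1 ‖h‖ ^ p * ‖h‖ ^ (-(((d + 1 : ℕ) : ℝ) + p * s))) ≠ ⊤ := by
  rw [lintegral_ofReal_ne_top_iff_integrable (by fun_prop)]
  · exact integrable_min_one_norm_rpow hs0 hs1 hp
  · refine Eventually.of_forall fun h => ?_
    have : 0 ≤ min 1 ‖h‖ := le_min zero_le_one (norm_nonneg _)
    simp only [Pi.zero_apply]
    positivity

namespace IsTestFunction

variable {φ : Space d → 𝕜}

lemma measurable (hφ : IsTestFunction d φ) : Measurable φ := hφ.1.continuous.measurable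

lemma exists_norm_sub_le (hφ : IsTestFunction d φ) :
    ∃ A : ℝ, 0 ≤ A ∧ ∀ x y, ‖φ x - φ y‖ ≤ A * min 1 ‖x - y‖ := by
  obtain ⟨L, hL⟩ := hφ.1.lipschitzWith_of_hasCompactSupport hφ.2.1 (by simp)
  obtain ⟨M, hM⟩ := hφ.2.1.exists_bound_of_continuous hφ.1.continuous
  have hM0 : 0 ≤ M := (norm_nonneg _).trans (hM 0)
  refine ⟨max L (2 * M), by positivity, fun x y => ?_⟩
  rcases le_total 1 ‖x - y‖ with h | h
  · rw [min_eq_left h, mul_one]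
    refine le_max_of_le_right ((norm_sub_le _ _).trans ?_)
    linarith [hM x, hM y]
  · rw [min_eq_right h]
    have h1 := hL.norm_sub_le x y
    refine h1.trans ?_
    gcongr
    exact le_max_left _ _

/-- Test functions have finite energy: near the diagonal because they are Lipschitz and `s < 1`. -/
lemma gagliardo_ne_top (hφ : IsTestFunction d φ) {p s : ℝ} (hp : 1 ≤ p) (hs0 : 0 < s)
    (hs1 : s < 1) : gagliardo d p s φ ≠ ⊤ := by
  obtain ⟨A, hA0, hA⟩ := hφ.exists_norm_sub_le
  have hp0 : 0 < p := by linarith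
  set q : ℝ := ((d + 1 : ℕ) : ℝ) + p * s with hq
  set k : Space d → ℝ≥0∞ := fun h => ENNReal.ofReal (min 1 ‖h‖ ^ p * ‖h‖ ^ (-q)) with hk
  have hkm : Measurable k := by fun_prop
  set I := ∫⁻ h, k h with hI
  have hItop : I ≠ ⊤ := lintegral_min_one_norm_rpow_ne_top hs0 hs1 hp
  set K := tsupport φ with hK
  have hKm : MeasurableSet K := (isClosed_tsupport φ).measurableSet
  have hKfin : volume K ≠ ⊤ := hφ.2.1.measure_lt_top.ne
  set χ : Space d → ℝ≥0∞ := K.indicator 1 with hχ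
  have hχm : Measurable χ := measurable_one.indicator hKm
  have hpt : ∀ z : Space d × Space d, ENNReal.ofReal (‖φ z.1 - φ z.2‖ ^ p / ‖z.1 - z.2‖ ^ q) ≤
      ENNReal.ofReal (A ^ p) * (χ z.1 * k (z.1 - z.2) + χ z.2 * k (z.1 - z.2)) := by
    rintro ⟨x, y⟩
    by_cases hxy : x ∈ K ∨ y ∈ K
    · have h1 : ENNReal.ofReal (‖φ x - φ y‖ ^ p / ‖x - y‖ ^ q) ≤
          ENNReal.ofReal (A ^ p) * k (x - y) := by
        rw [hk, ← ENNReal.ofReal_mul (by positivity)]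
        refine ENNReal.ofReal_le_ofReal ?_
        have hmin : 0 ≤ min 1 ‖x - y‖ := le_min zero_le_one (norm_nonneg _)
        rw [Real.rpow_neg (norm_nonneg _), div_eq_mul_inv, ← mul_assoc, ← Real.mul_rpow hA0 hmin]
        gcongr
        exact hA x y
      refine h1.trans ?_
      gcongr
      rcases hxy with h | h
      · simp only [hχ, indicator_of_mem h, Pi.one_apply, one_mul]
        exact le_self_add
      · simp only [hχ, indicator_of_mem h, Pi.one_apply, one_mul]
        exact le_add_self
    · rw [not_or] at hxy
      have hx : φ x = 0 := image_eq_zero_of_notMem_tsupport hxy.1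
      have hy : φ y = 0 := image_eq_zero_of_notMem_tsupport hxy.2
      simp [hx, hy, Real.zero_rpow hp0.ne']
  have h1 : ∫⁻ z : Space d × Space d, χ z.1 * k (z.1 - z.2) = volume K * I := by
    rw [Measure.volume_eq_prod, lintegral_prod _ (by fun_prop)]
    simp only
    have : ∀ x : Space d, ∫⁻ y, χ x * k (x - y) = χ x * I := fun x => by
      rw [lintegral_const_mul _ (by fun_prop), lintegral_sub_left_eq_self]
    simp_rw [this]
    rw [lintegral_mul_const _ hχm, hχ, lintegral_indicator_one hKm]
  have h2 : ∫⁻ z : Space d × Space d, χ z.2 * k (z.1 - z.2) = volume K * I := by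
    rw [Measure.volume_eq_prod, lintegral_prod_symm _ (by fun_prop)]
    simp only
    have : ∀ y : Space d, ∫⁻ x, χ y * k (x - y) = χ y * I := fun y => by
      rw [lintegral_const_mul _ (by fun_prop), lintegral_sub_right_eq_self]
    simp_rw [this]
    rw [lintegral_mul_const _ hχm, hχ, lintegral_indicator_one hKm]
  have h3 : gagliardo d p s φ ≤ ENNReal.ofReal (A ^ p) * (volume K * I + volume K * I) := by
    calc gagliardo d p s φ
        ≤ ∫⁻ z : Space d × Space d, ENNReal.ofReal (A ^ p) *
            (χ z.1 * k (z.1 - z.2) + χ z.2 * k (z.1 - z.2)) :=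
          (setLIntegral_le_lintegral _ _).trans (lintegral_mono hpt)
      _ = _ := by
          rw [lintegral_const_mul _ (by fun_prop), lintegral_add_left (by fun_prop), h1, h2]
  refine ne_top_of_le_ne_top ?_ h3
  have := ENNReal.mul_ne_top hKfin hItop
  exact ENNReal.mul_ne_top ENNReal.ofReal_ne_top (ENNReal.add_ne_top.2 ⟨this, this⟩)

lemma hardyTerm_ne_top (hφ : IsTestFunction d φ) {p s : ℝ} (hp : 1 ≤ p) :
    hardyTerm d p s φ ≠ ⊤ := by
  have hp0 : 0 < p := by linarith
  set K := tsupport φ with hK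
  have hKm : MeasurableSet K := (isClosed_tsupport φ).measurableSet
  set f : Space d → ℝ := fun x => ‖φ x‖ ^ p / x (Fin.last d) ^ (p * s) with hf
  have hcont : ContinuousOn f K := by
    refine ContinuousOn.div ?_ ?_ fun x hx => ?_
    · exact (hφ.1.continuous.norm.rpow_const fun x => Or.inr hp0.le).continuousOn
    · exact continuous_last.continuousOn.rpow_const fun x hx =>
        Or.inl (mem_halfSpace.1 (hφ.2.2 hx)).ne'
    · exact (Real.rpow_pos_of_pos (hφ.2.2 hx) _).ne'
  have hint : IntegrableOn f K := hcont.integrableOn_compact hφ.2.1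
  have hle : hardyTerm d p s φ ≤ ∫⁻ x in K, ENNReal.ofReal (f x) := by
    rw [← lintegral_indicator hKm, hardyTerm]
    refine (setLIntegral_le_lintegral _ _).trans (lintegral_mono fun x => ?_)
    by_cases hx : x ∈ K
    · rw [indicator_of_mem hx]
    · simp [image_eq_zero_of_notMem_tsupport hx, Real.zero_rpow hp0.ne']
  refine ne_top_of_le_ne_top ?_ hle
  rw [lintegral_ofReal_ne_top_iff_integrable hint.aestronglyMeasurable]
  · exact hint
  · filter_upwards [ae_restrict_mem hKm] with x hx
    have : 0 < x (Fin.last d) := hφ.2.2 hx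
    simp only [hf, Pi.zero_apply]
    positivity

end IsTestFunction

lemma gagliardo_le_add {p s : ℝ} (hp : 1 ≤ p) {f g : Space d → 𝕜} (hf : Measurable f)
    (hg : Measurable g) :
    gagliardo d p s f ≤
      ENNReal.ofReal ((1 / 2) ^ (1 - p)) * (gagliardo d p s (f - g) + gagliardo d p s g) := by
  have hfg : Measurable fun z : Space d × Space d => ENNReal.ofReal
    (‖(f - g) z.1 - (f - g) z.2‖ ^ p / ‖z.1 - z.2‖ ^ (((d + 1 : ℕ) : ℝ) + p * s)) := by
    simp only [Pi.sub_apply]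
    fun_prop
  unfold gagliardo
  rw [← lintegral_add_left hfg, ← lintegral_const_mul' _ _ ENNReal.ofReal_ne_top]
  refine lintegral_mono fun z => ?_
  rw [← ENNReal.ofReal_add (by positivity) (by positivity), ← ENNReal.ofReal_mul (by positivity),
    ← add_div, ← mul_div_assoc]
  refine ENNReal.ofReal_le_ofReal ?_
  gcongr
  have h := rpow_norm_add_le hp (l := 1 / 2) (by norm_num) (by norm_num)
    ((f - g) z.1 - (f - g) z.2) (g z.1 - g z.2)
  rw [show (1 : ℝ) - 1 / 2 = 1 / 2 by norm_num, ← mul_add] at h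
  refine le_of_eq_of_le ?_ h
  congr 2
  simp only [Pi.sub_apply]
  ring

lemma gagliardo_congr {p s : ℝ} {u v : Space d → 𝕜}
    (h : u =ᵐ[volume.restrict (halfSpace d)] v) : gagliardo d p s u = gagliardo d p s v := by
  unfold gagliardo
  rw [Measure.volume_eq_prod, ← Measure.prod_restrict]
  refine lintegral_congr_ae ?_
  filter_upwards [Measure.quasiMeasurePreserving_fst.ae h,
    Measure.quasiMeasurePreserving_snd.ae h] with z h1 h2
  rw [h1, h2]

lemma hardyTerm_congr {p s : ℝ} {u v : Space d → 𝕜}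
    (h : u =ᵐ[volume.restrict (halfSpace d)] v) : hardyTerm d p s u = hardyTerm d p s v := by
  refine lintegral_congr_ae ?_
  filter_upwards [h] with x hx
  rw [hx]

/-- Elements of the completion have finite Hardy term: the inequality for the approximating test
functions bounds their Hardy terms, and Fatou's lemma passes to the limit. -/
lemma exists_measurable_of_mem_sobolev {p s : ℝ} (hp : 1 ≤ p) (hs0 : 0 < s) (hs1 : s < 1)
    (hps : p * s ≠ 1) {u : Space d → 𝕜} (hu : u ∈ sobolev 𝕜 d p s) :
    ∃ v : Space d → 𝕜, Measurable v ∧ u =ᵐ[volume.restrict (halfSpace d)] v ∧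
      hardyTerm d p s v ≠ ⊤ := by
  obtain ⟨φ, hφ, hcauchy, hlim⟩ := hu
  have hp0 : 0 < p := by linarith
  have hum : AEMeasurable u (volume.restrict (halfSpace d)) :=
    aemeasurable_of_tendsto_metrizable_ae' (fun n => (hφ n).measurable.aemeasurable) hlim
  refine ⟨hum.mk u, hum.measurable_mk, hum.ae_eq_mk, ?_⟩
  rw [← hardyTerm_congr hum.ae_eq_mk]
  have hev : ∀ᶠ mn : ℕ × ℕ in atTop, gagliardo d p s (φ mn.1 - φ mn.2) ≤ 1 :=
    (hcauchy.eventually (gt_mem_nhds one_pos)).mono fun _ h => h.le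
  obtain ⟨⟨m1, m2⟩, hm⟩ := eventually_atTop.1 hev
  set m := max m1 m2 with hmdef
  set D := ENNReal.ofReal (hardyConst (d + 1) p s) with hD
  have hD0 : D ≠ 0 := by simpa [hD] using hardyConst_pos hp hs0 hs1 hps
  set B := ENNReal.ofReal ((1 / 2) ^ (1 - p)) * (1 + gagliardo d p s (φ m)) with hB
  have hBtop : B ≠ ⊤ := ENNReal.mul_ne_top ENNReal.ofReal_ne_top
    (ENNReal.add_ne_top.2 ⟨ENNReal.one_ne_top, (hφ m).gagliardo_ne_top hp hs0 hs1⟩)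
  have hbound : ∀ n ≥ m, hardyTerm d p s (φ n) ≤ B / D := by
    intro n hn
    rw [ENNReal.le_div_iff_mul_le (Or.inl hD0) (Or.inl ENNReal.ofReal_ne_top), mul_comm]
    refine (hardyConst_mul_hardyTerm_le hp hs0 hs1 (hφ n).measurable
      ((hφ n).hardyTerm_ne_top hp)).trans ?_
    refine (gagliardo_le_add hp (hφ n).measurable (hφ m).measurable).trans ?_
    rw [hB]
    gcongr
    exact hm (n, m) ⟨(le_max_left _ _).trans hn, le_max_right _ _⟩
  have hfatou : hardyTerm d p s u ≤ liminf (fun n => hardyTerm d p s (φ n)) atTop := by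
    have h1 : hardyTerm d p s u = ∫⁻ x in halfSpace d, liminf (fun n => ENNReal.ofReal
        (‖φ n x‖ ^ p / x (Fin.last d) ^ (p * s))) atTop := by
      refine lintegral_congr_ae ?_
      filter_upwards [hlim] with x hx
      refine (Tendsto.liminf_eq ?_).symm
      exact ENNReal.tendsto_ofReal ((hx.norm.rpow_const (Or.inr hp0.le)).div_const _)
    rw [h1]
    refine lintegral_liminf_le fun n => ?_
    have := (hφ n).measurable
    fun_prop
  refine ne_top_of_le_ne_top (ENNReal.div_ne_top hBtop hD0) (hfatou.trans ?_)
  refine liminf_le_of_frequently_le' (Eventually.frequently ?_)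
  exact eventually_atTop.2 ⟨m, hbound⟩

end Finiteness

/-! ### Almost invariant cutoff functions -/

section Cutoff

variable {d : ℕ} {𝕜 : Type*} [RCLike 𝕜]

/-- A smooth cutoff on the line, equal to `1` on `[-1, 1]` and supported in `[-2, 2]`. -/
noncomputable def lineBump : ContDiffBump (0 : ℝ) := ⟨1, 2, one_pos, one_lt_two⟩

/-- A smooth cutoff on `N`-dimensional space, equal to `1` on the ball of radius `2` and supported
in the ball of radius `3`. -/
noncomputable def spaceBump (d : ℕ) : ContDiffBump (0 : Space d) := ⟨2, 3, two_pos, by norm_num⟩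

/-- The horizontal scale of the cutoff. It exceeds the largest height in the support by the
factor `T`, so that the horizontal part of a fixed shear becomes negligible. -/
noncomputable def cutoffRadius (T : ℝ) : ℝ := T * Real.exp (2 * T)

/-- A cutoff in the half-space living on the heights with `|log x_N| ≤ 2 T`. -/
noncomputable def cutoff (d : ℕ) (T : ℝ) (x : Space d) : ℝ :=
  lineBump (Real.log (x (Fin.last d)) / T) * spaceBump d ((cutoffRadius T)⁻¹ • x)

/-- A set containing the support of the cutoff. -/
def outerBox (d : ℕ) (T : ℝ) : Set (Space d) :=
  {x | Real.exp (-(2 * T)) ≤ x (Fin.last d) ∧ x (Fin.last d) ≤ Real.exp (2 * T) ∧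
    ‖x‖ ≤ 3 * cutoffRadius T}

lemma cutoffRadius_pos {T : ℝ} (hT : 0 < T) : 0 < cutoffRadius T := by
  unfold cutoffRadius; positivity

lemma cutoff_nonneg (T : ℝ) (x : Space d) : 0 ≤ cutoff d T x :=
  mul_nonneg lineBump.nonneg (spaceBump d).nonneg

lemma cutoff_le_one (T : ℝ) (x : Space d) : cutoff d T x ≤ 1 :=
  mul_le_one₀ lineBump.le_one (spaceBump d).nonneg (spaceBump d).le_one

lemma measurable_cutoff (T : ℝ) : Measurable (cutoff d T) := by
  have h1 : Measurable (lineBump : ℝ → ℝ) := lineBump.continuous.measurable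
  have h2 : Measurable (spaceBump d : Space d → ℝ) := (spaceBump d).continuous.measurable
  unfold cutoff
  fun_prop

lemma isClosed_outerBox (T : ℝ) : IsClosed (outerBox d T) :=
  (isClosed_le continuous_const continuous_last).inter
    ((isClosed_le continuous_last continuous_const).inter
      (isClosed_le continuous_norm continuous_const))

lemma outerBox_subset_halfSpace (T : ℝ) : outerBox d T ⊆ halfSpace d :=
  fun _ hx => (Real.exp_pos _).trans_le hx.1

lemma isCompact_outerBox (T : ℝ) : IsCompact (outerBox d T) := by
  refine (isCompact_closedBall (0 : Space d) (3 * cutoffRadius T)).of_isClosed_subset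
    (isClosed_outerBox T) fun x hx => ?_
  simpa using hx.2.2

lemma mem_outerBox_of_cutoff_ne_zero {T : ℝ} (hT : 0 < T) {x : Space d} (hx : x ∈ halfSpace d)
    (h : cutoff d T x ≠ 0) : x ∈ outerBox d T := by
  have hx' : 0 < x (Fin.last d) := hx
  have h1 : |Real.log (x (Fin.last d)) / T| < 2 := by
    by_contra hn
    refine h (mul_eq_zero_of_left (lineBump.zero_of_le_dist ?_) _)
    rw [Real.dist_eq, sub_zero]
    exact not_lt.1 hn
  have h2 : ‖(cutoffRadius T)⁻¹ • x‖ < 3 := by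
    by_contra hn
    refine h (mul_eq_zero_of_right _ ((spaceBump d).zero_of_le_dist ?_))
    rw [dist_zero_right]
    exact not_lt.1 hn
  have hR := cutoffRadius_pos hT
  rw [abs_div, abs_of_pos hT, div_lt_iff₀ hT, abs_lt] at h1
  refine ⟨?_, ?_, ?_⟩
  · rw [← Real.le_log_iff_exp_le hx']; linarith
  · rw [← Real.log_le_iff_le_exp hx']; linarith
  · rw [norm_smul, norm_inv, Real.norm_of_nonneg hR.le, inv_mul_lt_iff₀ hR] at h2
    linarith

lemma cutoff_eq_one {T : ℝ} (hT : 0 < T) {x : Space d}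
    (h1 : |Real.log (x (Fin.last d))| ≤ T) (h2 : ‖x‖ ≤ 2 * cutoffRadius T) : cutoff d T x = 1 := by
  have hR := cutoffRadius_pos hT
  unfold cutoff
  rw [lineBump.one_of_mem_closedBall, (spaceBump d).one_of_mem_closedBall, one_mul]
  · rw [mem_closedBall_zero_iff, norm_smul, norm_inv, Real.norm_of_nonneg hR.le,
      inv_mul_le_iff₀ hR]
    change ‖x‖ ≤ cutoffRadius T * 2
    linarith
  · rw [mem_closedBall_zero_iff, Real.norm_eq_abs, abs_div, abs_of_pos hT, div_le_iff₀ hT]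
    change _ ≤ 1 * T
    linarith

/-- A bound for the variation of the cutoffs under the shear by `η`. -/
noncomputable def shearSize (η : Space d) : ℝ :=
  |Real.log (η (Fin.last d))| + (1 + (η (Fin.last d))⁻¹) * ‖η - unitPoint d‖

lemma shearSize_nonneg {η : Space d} (hη : η ∈ halfSpace d) : 0 ≤ shearSize η := by
  have : 0 < η (Fin.last d) := hη
  unfold shearSize; positivity

lemma abs_mul_sub_mul_le {a b a' b' : ℝ} (hb0 : 0 ≤ b) (hb1 : b ≤ 1) (ha0 : 0 ≤ a')
    (ha1 : a' ≤ 1) : |a * b - a' * b'| ≤ |a - a'| + |b - b'| := by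
  have : a * b - a' * b' = (a - a') * b + a' * (b - b') := by ring
  rw [this]
  refine (abs_add_le _ _).trans ?_
  rw [abs_mul, abs_mul, abs_of_nonneg hb0, abs_of_nonneg ha0]
  have h1 := abs_nonneg (a - a')
  have h2 := abs_nonneg (b - b')
  nlinarith

/-- The cutoffs vary slowly along the shears. -/
lemma exists_abs_cutoff_sub_le (d : ℕ) : ∃ L : ℝ, 0 ≤ L ∧ ∀ T : ℝ, 0 < T → ∀ x ∈ halfSpace d,
    ∀ η ∈ halfSpace d, (x ∈ outerBox d T ∨ shear η x ∈ outerBox d T) →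
      |cutoff d T x - cutoff d T (shear η x)| ≤ L * shearSize η / T := by
  obtain ⟨L1, hL1⟩ := (lineBump.contDiff (n := 1)).lipschitzWith_of_hasCompactSupport
    lineBump.hasCompactSupport one_ne_zero
  obtain ⟨L2, hL2⟩ := ((spaceBump d).contDiff (n := 1)).lipschitzWith_of_hasCompactSupport
    (spaceBump d).hasCompactSupport one_ne_zero
  refine ⟨L1 + L2, by positivity, fun T hT x hx η hη hbox => ?_⟩
  have hx' : 0 < x (Fin.last d) := hx
  have hη' : 0 < η (Fin.last d) := hη
  have hR := cutoffRadius_pos hT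
  have hE := Real.exp_pos (2 * T)
  have h1 : |lineBump (Real.log (x (Fin.last d)) / T) -
      lineBump (Real.log (shear η x (Fin.last d)) / T)| ≤
      L1 * (|Real.log (η (Fin.last d))| / T) := by
    refine (hL1.norm_sub_le _ _).trans (le_of_eq ?_)
    rw [shear_apply_last, Real.log_mul hx'.ne' hη'.ne', ← sub_div, sub_add_cancel_left, norm_div,
      norm_neg, Real.norm_eq_abs, Real.norm_of_nonneg hT.le]
  have hheight : x (Fin.last d) ≤ (1 + (η (Fin.last d))⁻¹) * Real.exp (2 * T) := by
    rcases hbox with h | h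
    · have : 0 < (η (Fin.last d))⁻¹ * Real.exp (2 * T) := by positivity
      linarith [h.2.1]
    · have h3 := h.2.1
      rw [shear_apply_last, ← le_div_iff₀ hη', div_eq_inv_mul] at h3
      linarith
  have h2 : |spaceBump d ((cutoffRadius T)⁻¹ • x) -
      spaceBump d ((cutoffRadius T)⁻¹ • shear η x)| ≤
      L2 * ((1 + (η (Fin.last d))⁻¹) * ‖η - unitPoint d‖ / T) := by
    refine (hL2.norm_sub_le _ _).trans ?_
    gcongr
    rw [← smul_sub, norm_smul, norm_sub_shear, abs_of_pos hx', norm_inv,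
      Real.norm_of_nonneg hR.le, cutoffRadius]
    calc (T * Real.exp (2 * T))⁻¹ * (x (Fin.last d) * ‖η - unitPoint d‖)
        ≤ (T * Real.exp (2 * T))⁻¹ *
          ((1 + (η (Fin.last d))⁻¹) * Real.exp (2 * T) * ‖η - unitPoint d‖) := by gcongr
      _ = _ := by field_simp
  refine (abs_mul_sub_mul_le (spaceBump d).nonneg (spaceBump d).le_one lineBump.nonneg
    lineBump.le_one).trans ((add_le_add h1 h2).trans ?_)
  have ha : 0 ≤ |Real.log (η (Fin.last d))| / T := by positivity
  have hb : 0 ≤ (1 + (η (Fin.last d))⁻¹) * ‖η - unitPoint d‖ / T := by positivity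
  have hsplit : (L1 + L2 : ℝ) * shearSize η / T =
      (L1 + L2 : ℝ) * (|Real.log (η (Fin.last d))| / T +
        (1 + (η (Fin.last d))⁻¹) * ‖η - unitPoint d‖ / T) := by
    rw [mul_div_assoc, shearSize, add_div]
  rw [hsplit]
  have := mul_nonneg (NNReal.coe_nonneg L1) hb
  have := mul_nonneg (NNReal.coe_nonneg L2) ha
  linarith

/-- The measure of a product set with respect to `dx / x_N`. -/
lemma lintegral_box (a r : ℝ) (ha : 0 ≤ a) (hr : 0 ≤ r) :
    ∫⁻ t in Ioi (0 : ℝ), ∫⁻ z : EuclideanSpace ℝ (Fin d), ENNReal.ofReal (t ^ (-1 : ℝ)) *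
      ((Icc (Real.exp (-a)) (Real.exp a)).indicator 1 t *
        (Metric.closedBall (0 : EuclideanSpace ℝ (Fin d)) r).indicator 1 z) =
      ENNReal.ofReal (2 * a) * (ENNReal.ofReal (r ^ d) *
        volume (Metric.ball (0 : EuclideanSpace ℝ (Fin d)) 1)) := by
  have hball : ∫⁻ z : EuclideanSpace ℝ (Fin d), (Metric.closedBall (0 : EuclideanSpace ℝ (Fin d))
      r).indicator 1 z = ENNReal.ofReal (r ^ d) *
        volume (Metric.ball (0 : EuclideanSpace ℝ (Fin d)) 1) := by
    rw [lintegral_indicator_one Metric.isClosed_closedBall.measurableSet,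
      Measure.addHaar_closedBall _ _ hr, finrank_euclideanSpace_fin]
  have hm1 : Measurable ((Metric.closedBall (0 : EuclideanSpace ℝ (Fin d)) r).indicator
      (1 : EuclideanSpace ℝ (Fin d) → ℝ≥0∞)) :=
    measurable_one.indicator Metric.isClosed_closedBall.measurableSet
  have hm2 : Measurable ((Icc (Real.exp (-a)) (Real.exp a)).indicator (1 : ℝ → ℝ≥0∞)) :=
    measurable_one.indicator measurableSet_Icc
  simp_rw [← mul_assoc]
  have h1 : ∀ t : ℝ, ∫⁻ z : EuclideanSpace ℝ (Fin d), ENNReal.ofReal (t ^ (-1 : ℝ)) *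
      (Icc (Real.exp (-a)) (Real.exp a)).indicator 1 t *
        (Metric.closedBall (0 : EuclideanSpace ℝ (Fin d)) r).indicator 1 z =
      ENNReal.ofReal (t ^ (-1 : ℝ)) * (Icc (Real.exp (-a)) (Real.exp a)).indicator 1 t *
        (ENNReal.ofReal (r ^ d) * volume (Metric.ball (0 : EuclideanSpace ℝ (Fin d)) 1)) := by
    intro t
    rw [lintegral_const_mul _ hm1, hball]
  simp_rw [h1]
  rw [lintegral_mul_const _ (by fun_prop), ← mul_assoc]
  congr 1
  have hexp : Real.exp (-a) ≤ Real.exp a := Real.exp_le_exp.2 (by linarith)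
  have hsub : Icc (Real.exp (-a)) (Real.exp a) ⊆ Ioi 0 := fun t ht =>
    (Real.exp_pos _).trans_le ht.1
  have h2 : ∀ t : ℝ, ENNReal.ofReal (t ^ (-1 : ℝ)) *
      (Icc (Real.exp (-a)) (Real.exp a)).indicator 1 t =
      (Icc (Real.exp (-a)) (Real.exp a)).indicator (fun t => ENNReal.ofReal t⁻¹) t := by
    intro t
    by_cases ht : t ∈ Icc (Real.exp (-a)) (Real.exp a)
    · simp [ht, Real.rpow_neg_one]
    · simp [ht]
  simp_rw [h2]
  rw [lintegral_indicator measurableSet_Icc, Measure.restrict_restrict measurableSet_Icc,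
    inter_eq_left.2 hsub]
  have hi : IntegrableOn (fun t : ℝ => t⁻¹) (Icc (Real.exp (-a)) (Real.exp a)) :=
    (continuousOn_inv₀.mono fun t ht => (hsub ht).ne').integrableOn_compact isCompact_Icc
  rw [← ofReal_integral_eq_lintegral_ofReal hi]
  · rw [integral_Icc_eq_integral_Ioc, ← intervalIntegral.integral_of_le hexp,
      integral_inv_of_pos (Real.exp_pos _) (Real.exp_pos _), ← Real.exp_sub, Real.log_exp]
    congr 2; ring
  · filter_upwards [ae_restrict_mem measurableSet_Icc] with t ht
    have : 0 < t := hsub ht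
    simp only [Pi.zero_apply]
    positivity

lemma norm_le_norm_joinLast (t : ℝ) (z : EuclideanSpace ℝ (Fin d)) : ‖z‖ ≤ ‖joinLast t z‖ := by
  refine le_of_sq_le_sq ?_ (norm_nonneg _)
  rw [norm_joinLast_sq]
  nlinarith [sq_nonneg t]

lemma hardyMeasure_apply {q : ℝ} {S : Set (Space d)} (hS : MeasurableSet S) :
    hardyMeasure d q S = ∫⁻ t in Ioi (0 : ℝ), ∫⁻ z : EuclideanSpace ℝ (Fin d),
      ENNReal.ofReal (t ^ (-q)) * S.indicator 1 (joinLast t z) := by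
  have hm : Measurable (S.indicator (1 : Space d → ℝ≥0∞)) := measurable_one.indicator hS
  have hm' : Measurable fun x : Space d =>
      ENNReal.ofReal (x (Fin.last d) ^ (-q)) * S.indicator 1 x := (measurable_rpow_last q).mul hm
  rw [← lintegral_indicator_one hS, lintegral_hardyMeasure _ hm,
    lintegral_halfSpace_eq_lintegral_joinLast hm']
  simp_rw [joinLast_last]

lemma hardyMeasure_outerBox_le {T : ℝ} (hT : 0 < T) :
    hardyMeasure d 1 (outerBox d T) ≤ ENNReal.ofReal (2 * (2 * T)) *
      (ENNReal.ofReal ((3 * cutoffRadius T) ^ d) *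
        volume (Metric.ball (0 : EuclideanSpace ℝ (Fin d)) 1)) := by
  have hR := cutoffRadius_pos hT
  rw [← lintegral_box _ _ (by positivity) (by positivity),
    hardyMeasure_apply (isClosed_outerBox T).measurableSet]
  refine lintegral_mono fun t => lintegral_mono fun z => ?_
  dsimp only
  gcongr
  by_cases h : joinLast t z ∈ outerBox d T
  · have h1 : t ∈ Icc (Real.exp (-(2 * T))) (Real.exp (2 * T)) := by
      simpa using And.intro h.1 h.2.1
    have h2 : z ∈ Metric.closedBall (0 : EuclideanSpace ℝ (Fin d)) (3 * cutoffRadius T) := by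
      rw [mem_closedBall_zero_iff]
      exact (norm_le_norm_joinLast t z).trans h.2.2
    rw [indicator_of_mem h, indicator_of_mem h1, indicator_of_mem h2]
    simp
  · rw [indicator_of_notMem h]
    exact zero_le

lemma lintegral_cutoff_ge {p T : ℝ} (hT : 1 ≤ T) :
    ENNReal.ofReal (2 * T) * (ENNReal.ofReal ((cutoffRadius T) ^ d) *
        volume (Metric.ball (0 : EuclideanSpace ℝ (Fin d)) 1)) ≤
      ∫⁻ x, ENNReal.ofReal (cutoff d T x ^ p) ∂(hardyMeasure d 1) := by
  have hT0 : 0 < T := by linarith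
  have hR := cutoffRadius_pos hT0
  have hm := measurable_cutoff (d := d) T
  rw [← lintegral_box _ _ hT0.le hR.le, lintegral_hardyMeasure _ (by fun_prop),
    lintegral_halfSpace_eq_lintegral_joinLast (by fun_prop)]
  refine lintegral_mono fun t => lintegral_mono fun z => ?_
  simp only [joinLast_last]
  gcongr
  by_cases h1 : t ∈ Icc (Real.exp (-T)) (Real.exp T)
  · by_cases h2 : z ∈ Metric.closedBall (0 : EuclideanSpace ℝ (Fin d)) (cutoffRadius T)
    · have ht : 0 < t := (Real.exp_pos _).trans_le h1.1
      have htR : t ≤ cutoffRadius T := by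
        refine h1.2.trans ((Real.exp_le_exp.2 (by linarith : T ≤ 2 * T)).trans ?_)
        exact le_mul_of_one_le_left (Real.exp_pos _).le hT
      rw [mem_closedBall_zero_iff] at h2
      rw [cutoff_eq_one hT0]
      · rw [Real.one_rpow, ENNReal.ofReal_one]
        exact mul_le_one' (indicator_le_self' (fun _ _ => zero_le) _)
          (indicator_le_self' (fun _ _ => zero_le) _)
      · rw [joinLast_last, abs_le, Real.le_log_iff_exp_le ht, Real.log_le_iff_le_exp ht]
        exact h1
      · refine le_of_sq_le_sq ?_ (by positivity)
        rw [norm_joinLast_sq]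
        nlinarith [norm_nonneg z]
    · rw [indicator_of_notMem h2, mul_zero]
      exact zero_le
  · rw [indicator_of_notMem h1, zero_mul]
    exact zero_le

/-- The measure of the support of a cutoff is at most a fixed multiple of its `L^p` norm. -/
lemma hardyMeasure_outerBox_le_lintegral {p T : ℝ} (hT : 1 ≤ T) :
    hardyMeasure d 1 (outerBox d T) ≤ ENNReal.ofReal (2 * 3 ^ d) *
      ∫⁻ x, ENNReal.ofReal (cutoff d T x ^ p) ∂(hardyMeasure d 1) := by
  have hT0 : 0 < T := by linarith
  have hR := cutoffRadius_pos hT0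
  refine (hardyMeasure_outerBox_le hT0).trans ?_
  refine le_trans (le_of_eq ?_) (mul_le_mul_right (lintegral_cutoff_ge hT) _)
  rw [← mul_assoc (ENNReal.ofReal _), ← ENNReal.ofReal_mul (by positivity),
    ← mul_assoc (ENNReal.ofReal (2 * 3 ^ d)), ← ENNReal.ofReal_mul (by positivity),
    ← mul_assoc (ENNReal.ofReal _), ← ENNReal.ofReal_mul (by positivity), mul_pow]
  congr 2; ring

lemma lintegral_cutoff_ne_zero {p T : ℝ} (hT : 1 ≤ T) :
    ∫⁻ x, ENNReal.ofReal (cutoff d T x ^ p) ∂(hardyMeasure d 1) ≠ 0 := by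
  have hT0 : 0 < T := by linarith
  have hR := cutoffRadius_pos hT0
  refine ((ENNReal.mul_pos ?_ (mul_ne_zero ?_ ?_)).trans_le (lintegral_cutoff_ge hT)).ne'
  · simpa using hT0
  · simpa using pow_pos hR d
  · exact (Metric.measure_ball_pos _ _ one_pos).ne'

end Cutoff

/-! ### Optimality of the constant -/

section Optimality

variable {d : ℕ} {𝕜 : Type*} [RCLike 𝕜]

/-- The virtual ground state `x_N ^ ((p s - 1) / p)` multiplied by a cutoff. -/
noncomputable def trialReal (d : ℕ) (p s T : ℝ) : Space d → ℝ :=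
  (halfSpace d).indicator fun x => x (Fin.last d) ^ ((p * s - 1) / p) * cutoff d T x

/-- The trial functions with values in the scalar field. -/
noncomputable def trial (𝕜 : Type*) [RCLike 𝕜] (d : ℕ) (p s T : ℝ) (x : Space d) : 𝕜 :=
  (trialReal d p s T x : 𝕜)

lemma trialReal_eq_zero {p s T : ℝ} (hT : 0 < T) {x : Space d} (hx : x ∉ outerBox d T) :
    trialReal d p s T x = 0 := by
  by_cases hxm : x ∈ halfSpace d
  · rw [trialReal, indicator_of_mem hxm, mul_eq_zero]
    exact Or.inr (by_contra fun h => hx (mem_outerBox_of_cutoff_ne_zero hT hxm h))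
  · rw [trialReal, indicator_of_notMem hxm]

lemma contDiff_trialReal {p s T : ℝ} (hT : 0 < T) : ContDiff ℝ ∞ (trialReal d p s T) := by
  rw [contDiff_iff_contDiffAt]
  intro x
  by_cases hx : x ∈ halfSpace d
  · have hx' : x (Fin.last d) ≠ 0 := (mem_halfSpace.1 hx).ne'
    have heq : trialReal d p s T =ᶠ[𝓝 x]
        fun x => x (Fin.last d) ^ ((p * s - 1) / p) * cutoff d T x := by
      filter_upwards [isOpen_halfSpace.mem_nhds hx] with y hy
      rw [trialReal, indicator_of_mem hy]
    refine ContDiffAt.congr_of_eventuallyEq ?_ heq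
    have hlast : ContDiffAt ℝ ∞ (fun x : Space d => x (Fin.last d)) x := by fun_prop
    have hlog : ContDiffAt ℝ ∞ (fun x : Space d => Real.log (x (Fin.last d)) / T) x :=
      (hlast.log hx').div_const T
    refine (hlast.rpow_const_of_ne hx').mul (ContDiffAt.mul ?_ ?_)
    · exact (lineBump.contDiff.contDiffAt).comp x hlog
    · exact ((spaceBump d).contDiff.contDiffAt).comp x (contDiffAt_id.const_smul _)
  · have hx' : x ∉ outerBox d T := fun h => hx (outerBox_subset_halfSpace T h)
    have heq : trialReal d p s T =ᶠ[𝓝 x] fun _ => 0 := by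
      filter_upwards [(isClosed_outerBox T).isOpen_compl.mem_nhds hx'] with y hy
      exact trialReal_eq_zero hT hy
    exact contDiffAt_const.congr_of_eventuallyEq heq

lemma isTestFunction_trial {p s T : ℝ} (hT : 0 < T) : IsTestFunction d (trial 𝕜 d p s T) := by
  have hzero : ∀ x ∉ outerBox d T, trial 𝕜 d p s T x = 0 := fun x hx => by
    rw [trial, trialReal_eq_zero hT hx, RCLike.ofReal_zero]
  have hsupp : tsupport (trial 𝕜 d p s T) ⊆ outerBox d T :=
    closure_minimal (fun x hx => by_contra fun h => hx (hzero x h)) (isClosed_outerBox T)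
  exact ⟨(RCLike.ofRealCLM (K := 𝕜)).contDiff.comp (contDiff_trialReal hT),
    HasCompactSupport.intro (isCompact_outerBox T) hzero,
    hsupp.trans (outerBox_subset_halfSpace T)⟩

lemma IsTestFunction.mem_sobolev {φ : Space d → 𝕜} (hφ : IsTestFunction d φ) {p s : ℝ}
    (hp : 1 ≤ p) : φ ∈ sobolev 𝕜 d p s := by
  have hp0 : p ≠ 0 := by positivity
  refine ⟨fun _ => φ, fun _ => hφ, ?_, Eventually.of_forall fun _ => tendsto_const_nhds⟩
  have : gagliardo d p s (φ - φ) = 0 := by simp [gagliardo, Real.zero_rpow hp0]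
  simp only [this]
  exact tendsto_const_nhds

lemma norm_trial {p s T : ℝ} {x : Space d} (hx : x ∈ halfSpace d) :
    ‖trial 𝕜 d p s T x‖ = x (Fin.last d) ^ ((p * s - 1) / p) * cutoff d T x := by
  have : 0 < x (Fin.last d) := hx
  have hχ := cutoff_nonneg T x
  rw [trial, RCLike.norm_ofReal, trialReal, indicator_of_mem hx, abs_of_nonneg (by positivity)]

/-- Multiplication by the virtual ground state is an isometry from `L^p(dx / x_N)` to
`L^p(x_N ^ (-p s) dx)`. -/
lemma lintegral_hardyMeasure_rpow_mul {p s : ℝ} (hp : 1 ≤ p) {f g : Space d → ℝ}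
    (hf : Measurable f) (hg : Measurable g) (hg0 : ∀ x, 0 ≤ g x)
    (hfg : ∀ x ∈ halfSpace d, f x = (x (Fin.last d) ^ ((p * s - 1) / p)) ^ p * g x) :
    ∫⁻ x, ENNReal.ofReal (f x) ∂(hardyMeasure d (p * s)) =
      ∫⁻ x, ENNReal.ofReal (g x) ∂(hardyMeasure d 1) := by
  have hp0 : p ≠ 0 := by positivity
  rw [lintegral_hardyMeasure _ (by fun_prop), lintegral_hardyMeasure _ (by fun_prop)]
  refine setLIntegral_congr_fun measurableSet_halfSpace fun x hx => ?_
  have hx' : 0 < x (Fin.last d) := hx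
  have := hg0 x
  simp only
  rw [hfg x hx, ← ENNReal.ofReal_mul (by positivity), ← ENNReal.ofReal_mul (by positivity),
    ← mul_assoc, ← Real.rpow_mul hx'.le, div_mul_cancel₀ _ hp0, ← Real.rpow_add hx']
  congr 3; ring

lemma hardyTerm_trial {p s T : ℝ} (hp : 1 ≤ p) (hT : 0 < T) :
    hardyTerm d p s (trial 𝕜 d p s T) =
      ∫⁻ x, ENNReal.ofReal (cutoff d T x ^ p) ∂(hardyMeasure d 1) := by
  have hm : Measurable (trial 𝕜 d p s T) := (isTestFunction_trial hT).measurable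
  have hχ := measurable_cutoff (d := d) T
  rw [hardyTerm_eq hm]
  refine lintegral_hardyMeasure_rpow_mul hp (by fun_prop) (by fun_prop)
    (fun x => Real.rpow_nonneg (cutoff_nonneg T x) p) fun x hx => ?_
  have hx' : 0 < x (Fin.last d) := hx
  rw [norm_trial hx, Real.mul_rpow (by positivity) (cutoff_nonneg T x)]

/-- The distance between a cutoff and its translate, in `L^p(dx / x_N)`. -/
noncomputable def cutoffDist (d : ℕ) (p T : ℝ) (η : Space d) : ℝ≥0∞ :=
  ∫⁻ x, ENNReal.ofReal (|cutoff d T x - cutoff d T (shear η x)| ^ p) ∂(hardyMeasure d 1)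

/-- The triangle inequality for `u - u ∘ S = x_N ^ β ((1 - ρ) χ ∘ S + (χ - χ ∘ S))`, where `S` is
the shear by `η`, `u = x_N ^ β χ`, and `ρ = η_N ^ β`. -/
lemma shearDist_trial_le {p s T l : ℝ} (hp : 1 ≤ p) (hT : 0 < T) (hl0 : 0 < l) (hl1 : l < 1)
    {η : Space d} (hη : η ∈ halfSpace d) :
    shearDist p s (trial 𝕜 d p s T) η ≤
      ENNReal.ofReal ((1 - l) ^ (1 - p)) *
        (ENNReal.ofReal (|1 - η (Fin.last d) ^ ((p * s - 1) / p)| ^ p) *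
          hardyTerm d p s (trial 𝕜 d p s T)) +
      ENNReal.ofReal (l ^ (1 - p)) * cutoffDist d p T η := by
  have h1l : 0 < 1 - l := by linarith
  have hη' : 0 < η (Fin.last d) := hη
  have hm : Measurable (trial 𝕜 d p s T) := (isTestFunction_trial hT).measurable
  have hms : Measurable fun x => trial 𝕜 d p s T (shear η x) := hm.comp (by fun_prop)
  have hχ := measurable_cutoff (d := d) T
  have hχs : Measurable fun x => cutoff d T (shear η x) := hχ.comp (by fun_prop)
  set β := (p * s - 1) / p with hβ
  set ρ := η (Fin.last d) ^ β with hρ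
  have hiso : shearDist p s (trial 𝕜 d p s T) η = ∫⁻ x, ENNReal.ofReal
      (|(1 - ρ) * cutoff d T (shear η x) + (cutoff d T x - cutoff d T (shear η x))| ^ p)
      ∂(hardyMeasure d 1) := by
    refine lintegral_hardyMeasure_rpow_mul hp (by fun_prop) (by fun_prop)
      (fun x => by positivity) fun x hx => ?_
    have hx' : 0 < x (Fin.last d) := hx
    have hxs := (shear_mem_halfSpace hη).2 hx
    rw [trial, trial, ← RCLike.ofReal_sub, RCLike.norm_ofReal, trialReal, indicator_of_mem hx,
      indicator_of_mem hxs, shear_apply_last, ← Real.mul_rpow (by positivity) (abs_nonneg _),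
      Real.mul_rpow hx'.le hη'.le, ← hβ, ← hρ]
    congr 1
    rw [← abs_of_pos (Real.rpow_pos_of_pos hx' β), ← abs_mul,
      abs_of_pos (Real.rpow_pos_of_pos hx' β)]
    congr 1; ring
  have hscale := lintegral_hardyMeasure_comp_shear 1 hη
    (f := fun x => ENNReal.ofReal (cutoff d T x ^ p)) (by fun_prop)
  rw [sub_self, Real.rpow_zero, ENNReal.ofReal_one, one_mul] at hscale
  rw [hiso, hardyTerm_trial hp hT, ← hscale, cutoffDist, ← lintegral_const_mul _ (by fun_prop),
    ← lintegral_const_mul _ (by fun_prop), ← lintegral_const_mul _ (by fun_prop),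
    ← lintegral_add_left (by fun_prop)]
  refine lintegral_mono fun x => ?_
  have hχ0 := cutoff_nonneg T (shear η x)
  dsimp only
  rw [← ENNReal.ofReal_mul (by positivity), ← ENNReal.ofReal_mul (by positivity),
    ← ENNReal.ofReal_mul (by positivity), ← ENNReal.ofReal_add (by positivity) (by positivity)]
  refine ENNReal.ofReal_le_ofReal ?_
  have h := rpow_norm_add_le hp hl0 hl1 ((1 - ρ) * cutoff d T (shear η x))
    (cutoff d T x - cutoff d T (shear η x))
  simp only [Real.norm_eq_abs] at h
  rwa [abs_mul, abs_of_nonneg hχ0, Real.mul_rpow (abs_nonneg _) hχ0] at h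

lemma measurable_cutoffDist (p T : ℝ) : Measurable (cutoffDist d p T) := by
  unfold cutoffDist
  have hχ := measurable_cutoff (d := d) T
  have h : Measurable fun z : Space d × Space d => cutoff d T (shear z.1 z.2) :=
    hχ.comp (by fun_prop)
  exact Measurable.lintegral_prod_right' (f := fun z : Space d × Space d =>
    ENNReal.ofReal (|cutoff d T z.2 - cutoff d T (shear z.1 z.2)| ^ p)) (by fun_prop)

lemma gagliardo_trial_le {p s T l : ℝ} (hp : 1 ≤ p) (hs0 : 0 < s) (hs1 : s < 1) (hT : 0 < T)
    (hl0 : 0 < l) (hl1 : l < 1) :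
    gagliardo d p s (trial 𝕜 d p s T) ≤
      ENNReal.ofReal ((1 - l) ^ (1 - p)) * (ENNReal.ofReal (hardyConst (d + 1) p s) *
        hardyTerm d p s (trial 𝕜 d p s T)) +
      ENNReal.ofReal (l ^ (1 - p)) *
        ∫⁻ η in halfSpace d, shearWeight d p s η * cutoffDist d p T η := by
  have hw := measurable_shearWeight (d := d) p s
  have hc := measurable_cutoffDist (d := d) p T
  rw [gagliardo_eq (isTestFunction_trial hT).measurable, ofReal_hardyConst_mul hp hs0 hs1,
    ← lintegral_const_mul _ (by fun_prop), ← lintegral_const_mul _ (by fun_prop),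
    ← lintegral_add_left (by fun_prop)]
  refine setLIntegral_mono' measurableSet_halfSpace fun η hη => ?_
  refine (mul_le_mul_right (shearDist_trial_le hp hT hl0 hl1 hη) _).trans (le_of_eq ?_)
  ring

/-- The cutoffs form a Følner family for the right translations: the distance between a cutoff and
its translate is small relative to the norm of the cutoff. -/
lemma exists_cutoffDist_le (d : ℕ) {p : ℝ} (hp : 1 ≤ p) : ∃ L : ℝ, 0 ≤ L ∧ ∀ T : ℝ, 1 ≤ T →
    ∀ η ∈ halfSpace d, cutoffDist d p T η ≤ ENNReal.ofReal (4 * 3 ^ d) *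
      (ENNReal.ofReal (min 1 (L * shearSize η / T) ^ p) *
        ∫⁻ x, ENNReal.ofReal (cutoff d T x ^ p) ∂(hardyMeasure d 1)) := by
  obtain ⟨L, hL0, hL⟩ := exists_abs_cutoff_sub_le d
  refine ⟨L, hL0, fun T hT η hη => ?_⟩
  have hT0 : 0 < T := by linarith
  have hp0 : 0 < p := by linarith
  have hS := shearSize_nonneg hη
  set M := hardyMeasure d 1 (outerBox d T) with hM
  set ψ : Space d → ℝ≥0∞ := (outerBox d T).indicator 1 with hψ
  have hψm : Measurable ψ := measurable_one.indicator (isClosed_outerBox T).measurableSet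
  have hψs : Measurable fun x => ψ (shear η x) := hψm.comp (by fun_prop)
  set ε := min 1 (L * shearSize η / T) with hε
  have hε0 : 0 ≤ ε := le_min zero_le_one (by positivity)
  have hpt : ∀ x ∈ halfSpace d,
      ENNReal.ofReal (|cutoff d T x - cutoff d T (shear η x)| ^ p) ≤
        ENNReal.ofReal (ε ^ p) * (ψ x + ψ (shear η x)) := by
    intro x hx
    by_cases hbox : x ∈ outerBox d T ∨ shear η x ∈ outerBox d T
    · have h1 : |cutoff d T x - cutoff d T (shear η x)| ≤ ε := by
        refine le_min ?_ (hL T hT0 x hx η hη hbox)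
        rw [abs_le]
        constructor <;> linarith [cutoff_nonneg T x, cutoff_nonneg T (shear η x),
          cutoff_le_one T x, cutoff_le_one T (shear η x)]
      refine (ENNReal.ofReal_le_ofReal (Real.rpow_le_rpow (abs_nonneg _) h1 hp0.le)).trans ?_
      refine le_mul_of_one_le_right zero_le ?_
      rcases hbox with h | h
      · rw [hψ, indicator_of_mem h]
        exact le_self_add
      · rw [hψ, indicator_of_mem h]
        exact le_add_self
    · rw [not_or] at hbox
      have h1 : cutoff d T x = 0 :=
        by_contra fun h => hbox.1 (mem_outerBox_of_cutoff_ne_zero hT0 hx h)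
      have h2 : cutoff d T (shear η x) = 0 := by_contra fun h =>
        hbox.2 (mem_outerBox_of_cutoff_ne_zero hT0 ((shear_mem_halfSpace hη).2 hx) h)
      simp [h1, h2, Real.zero_rpow hp0.ne']
  have hscale := lintegral_hardyMeasure_comp_shear 1 hη hψm
  rw [sub_self, Real.rpow_zero, ENNReal.ofReal_one, one_mul] at hscale
  have hψM : ∫⁻ x, ψ x ∂(hardyMeasure d 1) = M :=
    lintegral_indicator_one (isClosed_outerBox T).measurableSet
  calc cutoffDist d p T η
      ≤ ∫⁻ x, ENNReal.ofReal (ε ^ p) * (ψ x + ψ (shear η x)) ∂(hardyMeasure d 1) := by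
        refine lintegral_mono_ae (ae_hardyMeasure.2 ?_)
        filter_upwards [ae_restrict_mem measurableSet_halfSpace] with x hx using hpt x hx
    _ = ENNReal.ofReal (ε ^ p) * (M + M) := by
        rw [lintegral_const_mul _ (by fun_prop), lintegral_add_left hψm, hscale, hψM]
    _ ≤ ENNReal.ofReal (ε ^ p) * (2 * (ENNReal.ofReal (2 * 3 ^ d) *
          ∫⁻ x, ENNReal.ofReal (cutoff d T x ^ p) ∂(hardyMeasure d 1))) := by
        rw [← two_mul]
        gcongr
        exact hardyMeasure_outerBox_le_lintegral hT
    _ = _ := by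
        have h4 : ENNReal.ofReal (4 * 3 ^ d) = 2 * ENNReal.ofReal (2 * 3 ^ d) := by
          rw [← ENNReal.ofReal_ofNat 2, ← ENNReal.ofReal_mul zero_le_two]
          congr 1; ring
        rw [h4]
        ring

lemma abs_last_sub_one_le (η : Space d) : |η (Fin.last d) - 1| ≤ ‖η - unitPoint d‖ := by
  have h := PiLp.norm_apply_le (η - unitPoint d) (Fin.last d)
  simpa [Real.norm_eq_abs] using h

lemma shearSize_le {η : Space d} (h : ‖η - unitPoint d‖ ≤ 1 / 2) :
    shearSize η ≤ 5 * ‖η - unitPoint d‖ := by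
  have h1 := abs_last_sub_one_le η
  have h2 := abs_le.1 (h1.trans h)
  have ht : 1 / 2 ≤ η (Fin.last d) := by linarith [h2.1]
  have ht0 : 0 < η (Fin.last d) := by linarith
  have hinv : (η (Fin.last d))⁻¹ ≤ 2 := by
    rw [inv_le_comm₀ ht0 two_pos]; linarith
  have hinv0 : 0 < (η (Fin.last d))⁻¹ := inv_pos.2 ht0
  have hlog : |Real.log (η (Fin.last d))| ≤ 2 * ‖η - unitPoint d‖ := by
    have h3 := abs_le.1 h1
    rw [abs_le]
    constructor
    · have h4 := Real.one_sub_inv_le_log_of_pos ht0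
      have h5 : 1 - (η (Fin.last d))⁻¹ = (η (Fin.last d))⁻¹ * (η (Fin.last d) - 1) := by
        field_simp
      rw [h5] at h4
      have h6 : -((η (Fin.last d))⁻¹ * ‖η - unitPoint d‖) ≤
          (η (Fin.last d))⁻¹ * (η (Fin.last d) - 1) := by
        rw [← mul_neg]
        exact mul_le_mul_of_nonneg_left h3.1 hinv0.le
      nlinarith [norm_nonneg (η - unitPoint d)]
    · linarith [Real.log_le_sub_one_of_pos ht0, h3.2, norm_nonneg (η - unitPoint d)]
  unfold shearSize
  nlinarith [norm_nonneg (η - unitPoint d)]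

/-- The relative error of the trial functions tends to zero, by dominated convergence. -/
lemma tendsto_lintegral_min_shearSize {p s L : ℝ} (hp : 1 ≤ p) (hs0 : 0 < s) (hs1 : s < 1)
    (hL : 0 ≤ L) :
    Tendsto (fun n : ℕ => ∫⁻ η in halfSpace d, shearWeight d p s η *
      ENNReal.ofReal (min 1 (L * shearSize η / ((n : ℝ) + 1)) ^ p)) atTop (𝓝 0) := by
  have hp0 : 0 < p := by linarith
  have hw := measurable_shearWeight (d := d) p s
  have hSm : Measurable (shearSize (d := d)) := by unfold shearSize; fun_prop
  set A : ℝ := 5 * L + 2 with hA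
  have hA0 : 0 ≤ A := by positivity
  rw [← lintegral_zero (μ := volume.restrict (halfSpace d))]
  refine tendsto_lintegral_of_dominated_convergence' (fun η => ENNReal.ofReal (A ^ p) *
    (shearWeight d p s η * ENNReal.ofReal (min 1 ‖η - unitPoint d‖ ^ p)))
    (fun n => by fun_prop) (fun n => ?_) ?_ ?_
  · filter_upwards [ae_restrict_mem measurableSet_halfSpace] with η hη
    have hS := shearSize_nonneg hη
    have hn : (0 : ℝ) ≤ n := Nat.cast_nonneg n
    rw [mul_left_comm]
    gcongr
    have hmin0 : 0 ≤ min 1 ‖η - unitPoint d‖ := le_min zero_le_one (norm_nonneg _)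
    rw [← ENNReal.ofReal_mul (by positivity), ← Real.mul_rpow hA0 hmin0]
    refine ENNReal.ofReal_le_ofReal (Real.rpow_le_rpow (le_min zero_le_one (by positivity)) ?_
      hp0.le)
    have hdiv : L * shearSize η / ((n : ℝ) + 1) ≤ L * shearSize η :=
      div_le_self (by positivity) (by linarith)
    rcases le_total ‖η - unitPoint d‖ (1 / 2) with h | h
    · rw [min_eq_right (by linarith : ‖η - unitPoint d‖ ≤ 1)]
      refine (min_le_right _ _).trans (hdiv.trans ?_)
      have := mul_le_mul_of_nonneg_left (shearSize_le h) hL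
      nlinarith [norm_nonneg (η - unitPoint d)]
    · refine (min_le_left _ _).trans ?_
      have : 1 / 2 ≤ min 1 ‖η - unitPoint d‖ := le_min (by norm_num) h
      nlinarith
  · rw [lintegral_const_mul _ (by fun_prop)]
    refine ENNReal.mul_ne_top ENNReal.ofReal_ne_top ?_
    have h1 := lintegral_min_one_norm_rpow_ne_top (d := d) hs0 hs1 hp
    rw [← lintegral_sub_right_eq_self _ (unitPoint d)] at h1
    refine ne_top_of_le_ne_top h1 ((setLIntegral_le_lintegral _ _).trans
      (lintegral_mono fun η => ?_))
    rw [shearWeight, ← ENNReal.ofReal_mul (by positivity), mul_comm]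
  · refine Eventually.of_forall fun η => ?_
    have h1 : Tendsto (fun n : ℕ => L * shearSize η / ((n : ℝ) + 1)) atTop (𝓝 0) :=
      (tendsto_const_nhds.div_atTop
        (tendsto_atTop_add_const_right _ _ tendsto_natCast_atTop_atTop))
    have h2 : Tendsto (fun n : ℕ => ENNReal.ofReal
        (min 1 (L * shearSize η / ((n : ℝ) + 1)) ^ p)) atTop (𝓝 0) := by
      have h3 := ENNReal.tendsto_ofReal
        (((tendsto_const_nhds (x := (1 : ℝ))).min h1).rpow_const (p := p) (Or.inr hp0.le))
      simpa [Real.zero_rpow hp0.ne'] using h3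
    have h4 := ENNReal.Tendsto.const_mul (a := shearWeight d p s η) h2
      (Or.inr ENNReal.ofReal_ne_top)
    rwa [mul_zero] at h4

/-- Testing with the trial functions gives `C ≤ (1 - l) ^ (1 - p) D` as `T → ∞` for each weight `l`
of the triangle inequality; then `l → 0`. -/
theorem le_hardyConst_of_forall {p s C : ℝ} (hp : 1 ≤ p) (hs0 : 0 < s) (hs1 : s < 1)
    (hps : p * s ≠ 1)
    (hC : ∀ u ∈ sobolev 𝕜 d p s, ENNReal.ofReal C * hardyTerm d p s u ≤ gagliardo d p s u) :
    C ≤ hardyConst (d + 1) p s := by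
  obtain ⟨L, hL0, hL⟩ := exists_cutoffDist_le d hp
  have hD0 := hardyConst_pos (N := d + 1) hp hs0 hs1 hps
  set D := hardyConst (d + 1) p s with hD
  have hlim := tendsto_lintegral_min_shearSize (d := d) hp hs0 hs1 hL0
  set J : ℕ → ℝ≥0∞ := fun n => ∫⁻ η in halfSpace d, shearWeight d p s η *
      ENNReal.ofReal (min 1 (L * shearSize η / ((n : ℝ) + 1)) ^ p) with hJ
  have hw := measurable_shearWeight (d := d) p s
  have hSm : Measurable (shearSize (d := d)) := by unfold shearSize; fun_prop
  have hstep : ∀ l : ℝ, 0 < l → l < 1 → C ≤ (1 - l) ^ (1 - p) * D := by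
    intro l hl0 hl1
    have h1l : 0 < 1 - l := by linarith
    have hn : ∀ n : ℕ, ENNReal.ofReal C ≤ ENNReal.ofReal ((1 - l) ^ (1 - p)) * ENNReal.ofReal D +
        ENNReal.ofReal (l ^ (1 - p)) * ENNReal.ofReal (4 * 3 ^ d) * J n := by
      intro n
      set T : ℝ := (n : ℝ) + 1 with hTdef
      have hT1 : 1 ≤ T := by rw [hTdef]; linarith [Nat.cast_nonneg (α := ℝ) n]
      have hT0 : 0 < T := by linarith
      have htest := isTestFunction_trial (𝕜 := 𝕜) (d := d) (p := p) (s := s) hT0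
      set A := hardyTerm d p s (trial 𝕜 d p s T) with hA
      have hA0 : A ≠ 0 := by rw [hA, hardyTerm_trial hp hT0]; exact lintegral_cutoff_ne_zero hT1
      have hAtop : A ≠ ⊤ := htest.hardyTerm_ne_top hp
      have herr : ∫⁻ η in halfSpace d, shearWeight d p s η * cutoffDist d p T η ≤
          ENNReal.ofReal (4 * 3 ^ d) * J n * A := by
        rw [hJ, ← lintegral_const_mul _ (by fun_prop), ← lintegral_mul_const _ (by fun_prop)]
        refine setLIntegral_mono' measurableSet_halfSpace fun η hη => ?_
        refine (mul_le_mul_right (hL T hT1 η hη) _).trans (le_of_eq ?_)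
        rw [← hardyTerm_trial (𝕜 := 𝕜) (s := s) hp hT0]
        ring
      have h1 := (hC _ (htest.mem_sobolev hp)).trans
        (gagliardo_trial_le hp hs0 hs1 hT0 hl0 hl1)
      have h2 := h1.trans (add_le_add_right (mul_le_mul_right herr _) _)
      rw [← ENNReal.mul_le_mul_iff_left hA0 hAtop]
      refine h2.trans (le_of_eq ?_)
      ring
    have h3 : Tendsto (fun n => ENNReal.ofReal ((1 - l) ^ (1 - p)) * ENNReal.ofReal D +
        ENNReal.ofReal (l ^ (1 - p)) * ENNReal.ofReal (4 * 3 ^ d) * J n) atTop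
        (𝓝 (ENNReal.ofReal ((1 - l) ^ (1 - p)) * ENNReal.ofReal D)) := by
      have h4 := (tendsto_const_nhds
        (x := ENNReal.ofReal ((1 - l) ^ (1 - p)) * ENNReal.ofReal D)).add
        (ENNReal.Tendsto.const_mul (a := ENNReal.ofReal (l ^ (1 - p)) * ENNReal.ofReal (4 * 3 ^ d))
          hlim (Or.inr (ENNReal.mul_ne_top ENNReal.ofReal_ne_top ENNReal.ofReal_ne_top)))
      simpa using h4
    have h5 := ge_of_tendsto' h3 hn
    rw [← ENNReal.ofReal_mul (by positivity)] at h5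
    exact (ENNReal.ofReal_le_ofReal_iff (by positivity)).1 h5
  have hcont : Tendsto (fun l : ℝ => (1 - l) ^ (1 - p) * D) (𝓝[>] 0) (𝓝 D) := by
    have h1 : ContinuousAt (fun l : ℝ => (1 - l) ^ (1 - p) * D) 0 := by
      refine ContinuousAt.mul (ContinuousAt.rpow_const (by fun_prop) (Or.inl (by norm_num)))
        continuousAt_const
    have h2 : Tendsto (fun l : ℝ => (1 - l) ^ (1 - p) * D) (𝓝[>] 0)
        (𝓝 ((1 - 0) ^ (1 - p) * D)) := h1.tendsto.mono_left nhdsWithin_le_nhds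
    simpa using h2
  refine ge_of_tendsto hcont ?_
  filter_upwards [Ioo_mem_nhdsGT (zero_lt_one (α := ℝ))] with l hl using hstep l hl.1 hl.2

end Optimality

end FracHardy

/-- Sharp fractional Hardy inequality on the half-space of dimension `N = d + 1`, for real- or
complex-valued functions. -/
theorem theorem1p1 {𝕜 : Type*} [RCLike 𝕜] (d : ℕ) (p s : ℝ)
    (hp : 1 ≤ p) (hs0 : 0 < s) (hs1 : s < 1) (hps : p * s ≠ 1) :
    -- the integral in the constant converges
    IntervalIntegrable (FracHardy.constIntegrand p s) volume 0 1 ∧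
    -- the inequality
    (∀ u ∈ FracHardy.sobolev 𝕜 d p s,
      ENNReal.ofReal (FracHardy.hardyConst (d + 1) p s) * FracHardy.hardyTerm d p s u
        ≤ FracHardy.gagliardo d p s u) ∧
    -- optimality: no larger constant is admissible
    (∀ C : ℝ,
      (∀ u ∈ FracHardy.sobolev 𝕜 d p s,
        ENNReal.ofReal C * FracHardy.hardyTerm d p s u ≤ FracHardy.gagliardo d p s u) →
      C ≤ FracHardy.hardyConst (d + 1) p s) ∧
    -- the equality cases for `p = 1`, `N = 1`
    (p = 1 → d = 0 → ∀ u ∈ FracHardy.sobolev 𝕜 d p s,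
      (FracHardy.gagliardo d p s u
          = ENNReal.ofReal (FracHardy.hardyConst (d + 1) p s) * FracHardy.hardyTerm d p s u ↔
        ∃ (c : 𝕜) (g : ℝ → ℝ), AntitoneOn g (Ioi 0) ∧
          u =ᵐ[volume.restrict (FracHardy.halfSpace d)]
            fun x => c * (g (x (Fin.last d)) : 𝕜))) ∧
    -- strictness in all other cases
    ((1 < p ∨ (p = 1 ∧ 1 ≤ d)) → ∀ u ∈ FracHardy.sobolev 𝕜 d p s,
      ¬ (u =ᵐ[volume.restrict (FracHardy.halfSpace d)] 0) →
      ENNReal.ofReal (FracHardy.hardyConst (d + 1) p s) * FracHardy.hardyTerm d p s u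
        < FracHardy.gagliardo d p s u) := by
  have key : ∀ u ∈ FracHardy.sobolev 𝕜 d p s,
      ENNReal.ofReal (FracHardy.hardyConst (d + 1) p s) * FracHardy.hardyTerm d p s u
        ≤ FracHardy.gagliardo d p s u := by
    intro u hu
    obtain ⟨v, hv, huv, hH⟩ := FracHardy.exists_measurable_of_mem_sobolev hp hs0 hs1 hps hu
    rw [FracHardy.gagliardo_congr huv, FracHardy.hardyTerm_congr huv]
    exact FracHardy.hardyConst_mul_hardyTerm_le hp hs0 hs1 hv hH
  refine ⟨FracHardy.intervalIntegrable_constIntegrand hp hs0 hs1, key,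
    fun C hC => FracHardy.le_hardyConst_of_forall hp hs0 hs1 hps hC, ?_, ?_⟩
  · rintro rfl rfl u hu
    obtain ⟨v, hv, huv, hH⟩ := FracHardy.exists_measurable_of_mem_sobolev hp hs0 hs1 hps hu
    rw [FracHardy.gagliardo_congr huv, FracHardy.hardyTerm_congr huv]
    constructor
    · intro heq
      obtain ⟨c, g, hg, hcg⟩ := FracHardy.exists_antitoneOn_of_eq hs0 hs1 hv hH heq
      exact ⟨c, g, hg, huv.trans hcg⟩
    · rintro ⟨c, g, hg, hcg⟩
      exact FracHardy.eq_of_antitoneOn hs0 hs1 hv hH hg (huv.symm.trans hcg)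
  · intro hcase u hu hne
    refine lt_of_le_of_ne (key u hu) fun heq => hne ?_
    obtain ⟨v, hv, huv, hH⟩ := FracHardy.exists_measurable_of_mem_sobolev hp hs0 hs1 hps hu
    rw [FracHardy.gagliardo_congr huv, FracHardy.hardyTerm_congr huv] at heq
    refine huv.trans ?_
    rcases hcase with hp1 | ⟨rfl, hd⟩
    · exact FracHardy.ae_eq_zero_of_eq_of_one_lt hp1 hs0 hs1 hv hH heq.symm
    · exact FracHardy.ae_eq_zero_of_eq_of_one_le_dim hd hs0 hs1 hv hH heq.symm
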